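/- A point configuration $\mathcal A\subset\mathbb R^d$ is a finite multiset of points (repeated points are distinguished by labels) whose affine hull is $\mathbb R^d$. A *face* of a subconfiguration $F$ is $F\cap H$ for a supporting hyperplane $H$ of $\operatorname{conv}F$. A *subdivision* of $\mathcal A$ is a collection $\Sigma$ of non-empty subconfigurations such that faces of members are members, $\operatorname{conv}\mathcal A=\bigcup_{F\in\Sigma}\operatorname{conv}F$, and $\operatorname{relint}(\operatorname{conv}F)\cap\operatorname{relint}(\operatorname{conv}\bar F)=\emptyset$ for distinct $F,\bar F\in\Sigma$. The *trivial* subdivision consists of $\mathcal A$ and its faces. $\Sigma$ *refines* $\Sigma'$, and $\Sigma'$ *coarsens* $\Sigma$, if every member of $\Sigma$ is contained in a member of $\Sigma'$. $\Sigma$ is *coarsest* if it is non-trivial and the only subdivisions coarsening it are $\Sigma$ itself and the trivial one. A *$k$-subdivision* is a coarsest subdivision with exactly $k$ inclusion-maximal faces. A face $F\in\Sigma$ is *interior* if $\operatorname{conv}F\not\subseteq\partial\operatorname{conv}\mathcal A$. A *$k$-split* is a $k$-subdivision having an interior face of codimension $k-1$. The *tight span* of $\Sigma$ is the abstract polyhedral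 complex dual to the complex of interior faces of $\Sigma$: its non-empty faces correspond, with inclusions reversed, to the interior faces $F$ of $\Sigma$, the face dual to $F$ having dimension $d-\dim F$. For $w:\mathcal A\to\mathbb R$, the *regular subdivision* induced by $w$ consists of the sets $\{b\in\mathcal A : (w(b),b)\in G\}$, where $G$ runs over the non-empty bounded faces of the polyhedron $\operatorname{conv}\{(w(a),a) : a\in\mathcal A\}+\mathbb R_{\ge 0}(1,0,\dots,0)\subset\mathbb R\times\mathbb R^d$; a subdivision is *regular* if it is induced by some $w$. **Theorem.** Let $\mathcal A\subset\mathbb R^d$ be a point configuration. 1. The tight span of every $3$-subdivision of $\mathcal A$ is a triangle (that is, isomorphic, as an abstract polyhedral complex, to the complex of faces of a triangle), and every $3$-subdivision of $\mathcal A$ is a $3$-split. 2. Every subdivision of $\mathcal A$ (coarsest or not) with at most three maximal faces is regular. -/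

import Mathlib

namespace PointConfig

/-- `ℝ^d` with its Euclidean structure. -/
abbrev Space (d : ℕ) : Type := EuclideanSpace ℝ (Fin d)

/- A point configuration (a finite multiset of points of `ℝ^d`) is a family `A : ι → Space d` over a
finite index type; repeated points are distinguished by their labels. Subconfigurations are sets of
labels. -/
variable {d : ℕ} {ι : Type*}

/-- The convex hull of the subconfiguration `F`. -/
def hull (A : ι → Space d) (F : Set ι) : Set (Space d) :=
  convexHull ℝ (A '' F)

/-- The dimension of the affine hull of the (non-empty) subconfiguration `F`. -/
noncomputable def dim (A : ι → Space d) (F : Set ι) : ℕ :=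
  Module.finrank ℝ (vectorSpan ℝ (A '' F))

/-- `G` is a face of the subconfiguration `F`: there is a supporting hyperplane
`{x | ⟪u, x⟫ = c}` of `conv F` such that `G` consists of the elements of `F` lying on it. -/
def IsFace (A : ι → Space d) (G F : Set ι) : Prop :=
  ∃ (u : Space d) (c : ℝ), u ≠ 0 ∧
    (∀ x ∈ hull A F, c ≤ inner ℝ u x) ∧
    (∃ x ∈ hull A F, inner ℝ u x = c) ∧
    G = {i | i ∈ F ∧ inner ℝ u (A i) = c}

/-- A subdivision of the point configuration `A`, as a collection of (non-empty)
subconfigurations. -/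
structure IsSubdivision (A : ι → Space d) (S : Set (Set ι)) : Prop where
  nonempty_of_mem : ∀ F ∈ S, F.Nonempty
  face_mem : ∀ F ∈ S, ∀ G, IsFace A G F → G ∈ S
  hull_eq : hull A Set.univ = ⋃ F ∈ S, hull A F
  disjoint_relint : ∀ F ∈ S, ∀ G ∈ S, F ≠ G →
    intrinsicInterior ℝ (hull A F) ∩ intrinsicInterior ℝ (hull A G) = ∅

/-- The inclusion-maximal faces of `S`. -/
def maximalFaces (S : Set (Set ι)) : Set (Set ι) :=
  {F | Maximal (fun G => G ∈ S) F}

/-- `S` refines `T` (that is, `T` coarsens `S`). -/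
def Refines (S T : Set (Set ι)) : Prop :=
  ∀ F ∈ S, ∃ G ∈ T, F ⊆ G

/-- The trivial subdivision: the whole configuration together with its faces. -/
def trivialSubdivision (A : ι → Space d) : Set (Set ι) :=
  {F | F = Set.univ ∨ IsFace A F Set.univ}

/-- A coarsest subdivision: a non-trivial subdivision that cannot be coarsened except to itself and
to the trivial subdivision. -/
structure IsCoarsest (A : ι → Space d) (S : Set (Set ι)) : Prop where
  isSubdivision : IsSubdivision A S
  ne_trivial : S ≠ trivialSubdivision A
  eq_of_refines : ∀ T, IsSubdivision A T → Refines S T → T = S ∨ T = trivialSubdivision A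

/-- A `k`-subdivision: a coarsest subdivision with exactly `k` maximal faces. -/
def IsKSubdivision (A : ι → Space d) (k : ℕ) (S : Set (Set ι)) : Prop :=
  IsCoarsest A S ∧ (maximalFaces S).encard = k

/-- `F` is interior: `conv F` is not contained in the boundary of the convex hull of the whole
configuration. -/
def IsInterior (A : ι → Space d) (F : Set ι) : Prop :=
  ¬ hull A F ⊆ frontier (hull A Set.univ)

/-- A `k`-split: a `k`-subdivision with an interior face of codimension `k - 1`. -/
def IsKSplit (A : ι → Space d) (k : ℕ) (S : Set (Set ι)) : Prop :=
  IsKSubdivision A k S ∧ ∃ F ∈ S, IsInterior A F ∧ dim A F + k = d + 1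

/-- The tight span of `S`, as an abstract polyhedral complex: the poset of its non-empty faces,
which is dual to the poset of interior faces of `S`. -/
abbrev TightSpan (A : ι → Space d) (S : Set (Set ι)) : Type _ :=
  {F : Set ι // F ∈ S ∧ IsInterior A F}ᵒᵈ

/-- The dimension of the face of the tight span dual to an interior face `F` of `S`, namely the
codimension of `F`. -/
noncomputable def TightSpan.faceDim {A : ι → Space d} {S : Set (Set ι)} (x : TightSpan A S) : ℕ :=
  d - dim A (OrderDual.ofDual x).1

/-- The tight span of `S` is a triangle: it is isomorphic, as an abstract polyhedral complex, to the
complex of non-empty faces of a triangle, i.e. of non-empty subsets of its three vertices; a face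
with `m` vertices has dimension `m - 1`. -/
def TightSpanIsTriangle (A : ι → Space d) (S : Set (Set ι)) : Prop :=
  ∃ e : TightSpan A S ≃o {s : Finset (Fin 3) // s.Nonempty},
    ∀ x : TightSpan A S, x.faceDim + 1 = (e x).1.card

/-- The lifted polyhedron
`conv {(w(a), a) | a ∈ A} + ℝ_{≥ 0} (1, 0, …, 0) ⊆ ℝ × ℝ^d`. -/
def lift (A : ι → Space d) (w : ι → ℝ) : Set (ℝ × Space d) :=
  {p | ∃ q ∈ convexHull ℝ (Set.range fun i => (w i, A i)), ∃ t : ℝ, 0 ≤ t ∧ p = (q.1 + t, q.2)}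

/-- The regular subdivision of `A` induced by the weight function `w`: its members are the sets of
labels whose lifted points lie on a given lower (that is, bounded, non-empty) face of the lifted
polyhedron. -/
def regularSubdivision (A : ι → Space d) (w : ι → ℝ) : Set (Set ι) :=
  {F | ∃ G : Set (ℝ × Space d), IsExposed ℝ (lift A w) G ∧ G.Nonempty ∧ Bornology.IsBounded G ∧
    F = {i | (w i, A i) ∈ G}}

/-- `S` is regular: it is induced by some weight function. -/
def IsRegular (A : ι → Space d) (S : Set (Set ι)) : Prop :=
  ∃ w : ι → ℝ, S = regularSubdivision A w

end PointConfig

namespace PointConfig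

/-! ### Hulls, affine functions and faces -/

variable {d : ℕ} {ι : Type*}

/-! Maximal cells are full-dimensional with disjoint interiors, so any two are separated by a
hyperplane. Regularity follows once the separators can be chosen as differences `f k - f j` of
affine functions attached to the cells (`Coherent`): each cell is then the region where its function
is maximal, and the upper envelope serves as weight (`MaxCells.exists_weight`).

For three cells there is a dichotomy (`Cells.cutOff_or_coherent`). If no point interior to the whole
hull lies in all three cells, connectedness shows that one hyperplane cuts one cell off from the
other two. Otherwise take cyclic separators `h j` of `F j` and `F (j + 1)`. They are never
simultaneously negative on the hull and all vanish at the common point, so Hahn-Banach gives a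
nonzero relation `∑ l j * h j = 0` with nonnegative coefficients. If all coefficients are positive,
partial sums are coherent functions; if one vanishes, the two remaining hyperplanes coincide and cut
off a cell.

A cut-off subdivision is still regular, by an infinitesimal tilt of the cutting hyperplane
(`Cells.exists_coherent_of_mem`), but it is not coarsest, since the two cells on the same side can
be merged. A 3-subdivision therefore has coherent functions and a common interior point. Their
linear parts are affinely independent (`Cells.exists_spread`), so each nonempty set `I` of cells
meets in an interior face of codimension `|I| - 1`, and every interior face arises from exactly one
`I`: the tight span is a triangle. -/

theorem convex_hull (A : ι → Space d) (F : Set ι) : Convex ℝ (hull A F) := convex_convexHull ℝ _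

theorem mem_hull (A : ι → Space d) {F : Set ι} {i : ι} (hi : i ∈ F) : A i ∈ hull A F :=
  subset_convexHull ℝ _ ⟨i, hi, rfl⟩

theorem hull_mono (A : ι → Space d) {F G : Set ι} (h : F ⊆ G) : hull A F ⊆ hull A G :=
  convexHull_mono (Set.image_mono h)

theorem hull_subset {A : ι → Space d} {F : Set ι} {K : Set (Space d)} (hK : Convex ℝ K)
    (h : ∀ i ∈ F, A i ∈ K) : hull A F ⊆ K :=
  convexHull_min (by rintro _ ⟨i, hi, rfl⟩; exact h i hi) hK

theorem isCompact_hull [Finite ι] (A : ι → Space d) (F : Set ι) : IsCompact (hull A F) :=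
  (Set.toFinite (A '' F)).isCompact_convexHull ℝ

theorem isClosed_hull [Finite ι] (A : ι → Space d) (F : Set ι) : IsClosed (hull A F) :=
  (isCompact_hull A F).isClosed

theorem nonempty_of_mem_hull {A : ι → Space d} {F : Set ι} {x : Space d} (h : x ∈ hull A F) :
    F.Nonempty := by
  have : (hull A F).Nonempty := ⟨x, h⟩
  simpa [hull] using this

theorem convex_nonneg (g : Space d →ᵃ[ℝ] ℝ) : Convex ℝ {x | 0 ≤ g x} :=
  (convex_Ici (0 : ℝ)).affine_preimage g

theorem nonneg_on_hull {A : ι → Space d} {F : Set ι} {g : Space d →ᵃ[ℝ] ℝ}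
    (h : ∀ i ∈ F, 0 ≤ g (A i)) {x : Space d} (hx : x ∈ hull A F) : 0 ≤ g x :=
  hull_subset (convex_nonneg g) h hx

theorem continuous_affine (g : Space d →ᵃ[ℝ] ℝ) : Continuous g :=
  g.continuous_of_finiteDimensional

theorem exists_inner_eq (g : Space d →ᵃ[ℝ] ℝ) : ∃ u : Space d, ∀ x, g x = inner ℝ u x + g 0 := by
  let l : Space d →L[ℝ] ℝ := LinearMap.toContinuousLinearMap g.linear
  refine ⟨(InnerProductSpace.toDual ℝ (Space d)).symm l, fun x => ?_⟩
  rw [InnerProductSpace.toDual_symm_apply]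
  have := g.linearMap_vsub x 0
  simp only [vsub_eq_sub, sub_zero] at this
  change g x = g.linear x + g 0
  rw [this]; ring

/-- The affine function `x ↦ ⟪u, x⟫ + c`. -/
noncomputable def innerAffine (u : Space d) (c : ℝ) : Space d →ᵃ[ℝ] ℝ :=
  (innerSL ℝ u).toLinearMap.toAffineMap + AffineMap.const ℝ (Space d) c

@[simp] theorem innerAffine_apply (u : Space d) (c : ℝ) (x : Space d) :
    innerAffine u c x = inner ℝ u x + c := by simp [innerAffine]

theorem affine_lineMap (g : Space d →ᵃ[ℝ] ℝ) (x y : Space d) (t : ℝ) :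
    g (AffineMap.lineMap x y t) = g x + t * (g y - g x) := by
  rw [AffineMap.apply_lineMap, AffineMap.lineMap_apply]; simp; ring

/-- Being nonnegative, and in the hull of the zero labels if zero, is a convex condition: a positive
combination of nonnegative values vanishes only if both do. -/
theorem mem_hull_zero {A : ι → Space d} {F : Set ι} {g : Space d →ᵃ[ℝ] ℝ}
    (h : ∀ i ∈ F, 0 ≤ g (A i)) {x : Space d} (hx : x ∈ hull A F) (hgx : g x = 0) :
    x ∈ hull A {i | i ∈ F ∧ g (A i) = 0} := by
  set G := {i | i ∈ F ∧ g (A i) = 0}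
  have key : hull A F ⊆ {y | 0 ≤ g y ∧ (g y = 0 → y ∈ hull A G)} := by
    refine hull_subset ?_ fun i hi => ⟨h i hi, fun h0 => mem_hull A ⟨hi, h0⟩⟩
    rintro p ⟨hp, hp'⟩ q ⟨hq, hq'⟩ a b ha hb hab
    have e : g (a • p + b • q) = a * g p + b * g q := by
      have := Convex.combo_affine_apply (f := g) (x := p) (y := q) hab
      simpa using this
    refine ⟨by rw [e]; positivity, fun h0 => ?_⟩
    rw [e] at h0
    rcases ha.eq_or_lt with rfl | ha'
    · obtain rfl : b = 1 := by linarith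
      simpa using hq' (by linarith)
    rcases hb.eq_or_lt with rfl | hb'
    · obtain rfl : a = 1 := by linarith
      simpa using hp' (by linarith)
    have h1 : 0 ≤ a * g p := by positivity
    have h2 : 0 ≤ b * g q := by positivity
    have h3 : g p = 0 := by
      have : a * g p = 0 := by linarith
      simpa [ha'.ne'] using this
    have h4 : g q = 0 := by
      have : b * g q = 0 := by linarith
      simpa [hb'.ne'] using this
    exact convex_hull A G (hp' h3) (hq' h4) ha hb hab
  exact (key hx).2 hgx

/-- For small `ε` the sign of `p + ε q` is decided lexicographically. This makes faces of faces
faces, and later tilts hyperplanes. -/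
theorem exists_perturbation [Finite ι] (F : Set ι) (p q : ι → ℝ) (hp : ∀ i ∈ F, 0 ≤ p i)
    (hq : ∀ i ∈ F, p i = 0 → 0 ≤ q i) :
    ∃ ε : ℝ, 0 < ε ∧ (∀ i ∈ F, 0 ≤ p i + ε * q i) ∧
      ∀ i ∈ F, (p i + ε * q i = 0 ↔ p i = 0 ∧ q i = 0) := by
  have h : ∀ i, ∀ᶠ ε in nhdsWithin (0 : ℝ) (Set.Ioi 0), i ∈ F → 0 < p i → 0 < p i + ε * q i := by
    intro i
    by_cases hi : 0 < p i
    · have : Filter.Tendsto (fun ε : ℝ => p i + ε * q i) (nhds 0) (nhds (p i + 0 * q i)) :=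
        Continuous.tendsto (by fun_prop) 0
      have := this.eventually (lt_mem_nhds (show 0 < p i + 0 * q i by simpa using hi))
      filter_upwards [nhdsWithin_le_nhds this] with ε he _ _ using he
    · exact Filter.Eventually.of_forall fun ε _ h => absurd h hi
  obtain ⟨ε, h1, h0⟩ := ((Filter.eventually_all.2 h).and self_mem_nhdsWithin).exists
  have h0 : 0 < ε := h0
  refine ⟨ε, h0, fun i hi => ?_, fun i hi => ?_⟩
  · rcases (hp i hi).eq_or_lt with h | h
    · rw [← h]; have := hq i hi h.symm; positivity
    · exact (h1 i hi h).le
  · rcases (hp i hi).eq_or_lt with h | h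
    · rw [← h]; simp [h0.ne']
    · exact ⟨fun h' => absurd h' (h1 i hi h).ne', fun h' => absurd h'.1 h.ne'⟩

/-- `G` is `F` or a face of `F`: the set of the elements of `F` on which an affine function that is
non-negative on `F` vanishes. -/
def WeakFace (A : ι → Space d) (G F : Set ι) : Prop :=
  G.Nonempty ∧ ∃ g : Space d →ᵃ[ℝ] ℝ, (∀ i ∈ F, 0 ≤ g (A i)) ∧ G = {i | i ∈ F ∧ g (A i) = 0}

theorem WeakFace.subset {A : ι → Space d} {G F : Set ι} (h : WeakFace A G F) : G ⊆ F := by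
  obtain ⟨-, g, -, rfl⟩ := h
  exact fun i hi => hi.1

theorem WeakFace.refl (A : ι → Space d) {F : Set ι} (h : F.Nonempty) : WeakFace A F F :=
  ⟨h, 0, by simp, by simp⟩

theorem WeakFace.trans [Finite ι] {A : ι → Space d} {H G F : Set ι} (h : WeakFace A H G)
    (h' : WeakFace A G F) : WeakFace A H F := by
  obtain ⟨-, p, hp, rfl⟩ := h'
  obtain ⟨hne, q, hq, rfl⟩ := h
  obtain ⟨ε, -, h1, h2⟩ := exists_perturbation F (fun i => p (A i)) (fun i => q (A i)) hp
    (fun i hi h0 => hq i ⟨hi, h0⟩)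
  refine ⟨hne, p + ε • q, fun i hi => by simpa using h1 i hi, ?_⟩
  ext i
  simp only [Set.mem_ofPred_eq, AffineMap.coe_add, AffineMap.coe_smul, Pi.add_apply, Pi.smul_apply,
    smul_eq_mul]
  constructor
  · rintro ⟨⟨a, b⟩, c⟩
    exact ⟨a, (h2 i a).2 ⟨b, c⟩⟩
  · rintro ⟨a, b⟩
    have := (h2 i a).1 b
    exact ⟨⟨a, this.1⟩, this.2⟩

theorem weakFace_of_isFace {A : ι → Space d} {G F : Set ι} (h : IsFace A G F) : WeakFace A G F := by
  obtain ⟨u, c, -, h1, ⟨x, hx, hxc⟩, rfl⟩ := h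
  have hF : ∀ i ∈ F, 0 ≤ innerAffine u (-c) (A i) := fun i hi => by
    have := h1 _ (mem_hull A hi); simp; linarith
  have he : {i | i ∈ F ∧ inner ℝ u (A i) = c} = {i | i ∈ F ∧ innerAffine u (-c) (A i) = 0} := by
    ext i; simp [add_neg_eq_zero]
  refine ⟨?_, innerAffine u (-c), hF, he⟩
  rw [he]
  exact nonempty_of_mem_hull (mem_hull_zero hF hx (by simp [hxc]))

theorem WeakFace.eq_or_isFace {A : ι → Space d} {G F : Set ι} (h : WeakFace A G F) :
    G = F ∨ IsFace A G F := by
  obtain ⟨hne, g, hg, rfl⟩ := h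
  obtain ⟨u, hu⟩ := exists_inner_eq g
  obtain ⟨j, hj⟩ := hne
  by_cases h0 : u = 0
  · left
    ext i
    refine ⟨fun h => h.1, fun h => ⟨h, ?_⟩⟩
    have h1 := hu (A i)
    have h2 := hu (A j)
    rw [hj.2] at h2
    simp [h0] at h1 h2
    linarith
  · right
    refine ⟨u, -g 0, h0, fun x hx => ?_, ⟨A j, mem_hull A hj.1, ?_⟩, ?_⟩
    · have := nonneg_on_hull hg hx
      rw [hu] at this; linarith
    · have := hu (A j)
      rw [hj.2] at this; linarith
    · ext i
      simp only [Set.mem_ofPred_eq, hu (A i)]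
      refine and_congr_right fun _ => ⟨fun h => by linarith, fun h => by linarith⟩

theorem IsSubdivision.weakFace_mem {A : ι → Space d} {S : Set (Set ι)} (hS : IsSubdivision A S)
    {F G : Set ι} (hF : F ∈ S) (h : WeakFace A G F) : G ∈ S := by
  rcases h.eq_or_isFace with rfl | h
  · exact hF
  · exact hS.face_mem F hF G h

/-! ### Relative interiors -/

theorem exists_lineMap_neg_mem {s : Set (Space d)} {x y : Space d}
    (hx : x ∈ intrinsicInterior ℝ s) (hy : y ∈ s) :
    ∃ ε : ℝ, 0 < ε ∧ AffineMap.lineMap x y (-ε) ∈ s := by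
  obtain ⟨x', hx', rfl⟩ := mem_intrinsicInterior.1 hx
  let γ : ℝ → affineSpan ℝ s := fun t =>
    ⟨AffineMap.lineMap (x' : Space d) y (-t),
      AffineMap.lineMap_mem _ x'.2 (subset_affineSpan ℝ s hy)⟩
  have hγ : Continuous γ := by
    refine Continuous.subtype_mk ?_ _
    exact AffineMap.lineMap_continuous.comp continuous_neg
  have h0 : γ 0 = x' := by ext1; simp [γ]
  have h3 : ∀ᶠ t in nhds (0 : ℝ), (γ t : Space d) ∈ s :=
    (hγ.tendsto 0).eventually (by rw [h0]; exact mem_interior_iff_mem_nhds.1 hx')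
  have h4 : ∀ᶠ t in nhdsWithin (0 : ℝ) (Set.Ioi 0), (γ t : Space d) ∈ s := nhdsWithin_le_nhds h3
  obtain ⟨ε, h1, h2⟩ := (h4.and self_mem_nhdsWithin).exists
  exact ⟨ε, h2, h1⟩

/-- The cylinder over `s` along the orthogonal projection to its affine span has nonempty interior,
which reduces the claim to separating `x` from an open convex set; positivity somewhere on `s`
survives because relative interior points are interior to the cylinder. -/
theorem exists_support_of_notMem_intrinsicInterior {s : Set (Space d)} (hs : Convex ℝ s)
    {x : Space d} (hx : x ∈ s) (hx' : x ∉ intrinsicInterior ℝ s) :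
    ∃ g : Space d →ᵃ[ℝ] ℝ, (∀ y ∈ s, 0 ≤ g y) ∧ g x = 0 ∧ ∃ y ∈ s, 0 < g y := by
  obtain ⟨z, hz⟩ := Set.Nonempty.intrinsicInterior hs ⟨x, hx⟩
  obtain ⟨z', hz', rfl⟩ := mem_intrinsicInterior.1 hz
  have : Nonempty (affineSpan ℝ s) := ⟨z'⟩
  let π := EuclideanGeometry.orthogonalProjection (affineSpan ℝ s)
  have hπ : Continuous π := π.continuous
  let N : Set (Space d) := {y | (π y : Space d) ∈ s}
  have hN : Convex ℝ N :=
    hs.affine_preimage ((affineSpan ℝ s).subtype.comp π.toAffineMap)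
  have hπs : ∀ y : affineSpan ℝ s, (π y : Space d) = y := fun y =>
    EuclideanGeometry.orthogonalProjection_eq_self_iff.2 y.2
  have hsN : s ⊆ N := fun y hy => by
    change (π y : Space d) ∈ s
    rw [hπs ⟨y, subset_affineSpan ℝ s hy⟩]; exact hy
  have hzN : (z' : Space d) ∈ interior N := by
    rw [mem_interior]
    refine ⟨π ⁻¹' interior ((↑) ⁻¹' s), fun y hy => ?_, isOpen_interior.preimage hπ, ?_⟩
    · have h : π y ∈ interior ((↑) ⁻¹' s : Set (affineSpan ℝ s)) := hy
      have h' := interior_subset h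
      exact h'
    · have : π (z' : Space d) = z' := Subtype.ext (hπs z')
      simpa [this] using hz'
  have hxN : x ∉ interior N := by
    intro h
    refine hx' (mem_intrinsicInterior.2 ⟨⟨x, subset_affineSpan ℝ s hx⟩, ?_, rfl⟩)
    rw [mem_interior]
    refine ⟨((↑) : affineSpan ℝ s → Space d) ⁻¹' interior N, fun y hy => ?_,
      isOpen_interior.preimage continuous_subtype_val, h⟩
    have hy' : (y : Space d) ∈ interior N := hy
    have h' := interior_subset hy'
    have h'' : (π (y : Space d) : Space d) ∈ s := h'
    rwa [hπs] at h''
  obtain ⟨f, hf⟩ := geometric_hahn_banach_open_point hN.interior isOpen_interior hxN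
  refine ⟨AffineMap.const ℝ _ (f x) - f.toLinearMap.toAffineMap, fun y hy => ?_, by simp,
    z', intrinsicInterior_subset hz, by simpa using hf _ hzN⟩
  have : y ∈ closure (interior N) := by
    rw [hN.closure_interior_eq_closure_of_nonempty_interior ⟨_, hzN⟩]
    exact subset_closure (hsN hy)
  have h2 : f y ≤ f x := closure_minimal (t := {y | f y ≤ f x}) (fun y hy => (hf y hy).le)
    (isClosed_le f.continuous continuous_const) this
  simpa using h2

/-- As long as `x` is not relatively interior, a supporting function passes to a face with fewer
labels that still contains `x`. -/
theorem exists_weakFace_intrinsicInterior [Finite ι] (A : ι → Space d) (F : Set ι) {x : Space d}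
    (hx : x ∈ hull A F) : ∃ G, WeakFace A G F ∧ x ∈ intrinsicInterior ℝ (hull A G) := by
  induction h : F.ncard using Nat.strong_induction_on generalizing F with
  | _ n ih =>
    by_cases hx' : x ∈ intrinsicInterior ℝ (hull A F)
    · exact ⟨F, WeakFace.refl A (nonempty_of_mem_hull hx), hx'⟩
    obtain ⟨g, hg, hgx, y, hy, hgy⟩ :=
      exists_support_of_notMem_intrinsicInterior (convex_hull A F) hx hx'
    have hgF : ∀ i ∈ F, 0 ≤ g (A i) := fun i hi => hg _ (mem_hull A hi)
    have hxG := mem_hull_zero hgF hx hgx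
    set G := {i | i ∈ F ∧ g (A i) = 0} with hG
    have hlt : G.ncard < F.ncard := by
      refine Set.ncard_lt_ncard ⟨fun i hi => hi.1, fun hFG => ?_⟩ (Set.toFinite F)
      have : 0 ≤ (-g) y := nonneg_on_hull (g := -g) (fun i hi => by simp [(hFG hi).2]) hy
      simp at this
      linarith
    obtain ⟨H, hH, hxH⟩ := ih _ (h ▸ hlt) G hxG rfl
    exact ⟨H, hH.trans ⟨nonempty_of_mem_hull hxG, g, hgF, hG⟩, hxH⟩

theorem zero_of_intrinsicInterior {s : Set (Space d)} {g : Space d →ᵃ[ℝ] ℝ}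
    (hg : ∀ y ∈ s, 0 ≤ g y) {x : Space d} (hx : x ∈ intrinsicInterior ℝ s) (h0 : g x = 0) :
    ∀ y ∈ s, g y = 0 := by
  intro y hy
  obtain ⟨ε, he, h⟩ := exists_lineMap_neg_mem hx hy
  have h1 := hg _ h
  rw [affine_lineMap, h0] at h1
  have h2 := hg y hy
  nlinarith

/-! ### Combinatorics of subdivisions -/

theorem WeakFace.mem_of_mem_hull {A : ι → Space d} {G F : Set ι} (h : WeakFace A G F) {i : ι}
    (hi : i ∈ F) (hx : A i ∈ hull A G) : i ∈ G := by
  obtain ⟨-, g, hg, rfl⟩ := h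
  have : 0 ≤ (-g) (A i) := nonneg_on_hull (g := -g) (fun j hj => by simp [hj.2]) hx
  have h1 := hg i hi
  simp at this
  exact ⟨hi, le_antisymm this h1⟩

theorem WeakFace.mem_hull_of_openSegment {A : ι → Space d} {G F : Set ι} (h : WeakFace A G F)
    {x y m : Space d} (hx : x ∈ hull A F) (hy : y ∈ hull A F) (hm : m ∈ hull A G)
    (hmxy : m ∈ openSegment ℝ x y) : x ∈ hull A G ∧ y ∈ hull A G := by
  obtain ⟨-, g, hg, rfl⟩ := h
  have h0 : 0 ≤ (-g) m := nonneg_on_hull (g := -g) (fun j hj => by simp [hj.2]) hm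
  obtain ⟨a, b, ha, hb, hab, rfl⟩ := hmxy
  have e : g (a • x + b • y) = a * g x + b * g y := by
    simpa using Convex.combo_affine_apply (f := g) (x := x) (y := y) hab
  have h1 := nonneg_on_hull hg hx
  have h2 := nonneg_on_hull hg hy
  have h0' : a * g x + b * g y ≤ 0 := by
    rw [← e]; simpa using h0
  have h3 : 0 ≤ a * g x := by positivity
  have h4 : 0 ≤ b * g y := by positivity
  have h5 : a * g x = 0 := by linarith
  have h6 : b * g y = 0 := by linarith
  exact ⟨mem_hull_zero hg hx (by simpa [ha.ne'] using h5),
    mem_hull_zero hg hy (by simpa [hb.ne'] using h6)⟩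

/-- The weak face of `G` having `x` in its relative interior is a member of `S`, hence equals `F` by
disjointness. This is how intersections of cells are controlled throughout. -/
theorem IsSubdivision.weakFace_of_mem [Finite ι] {A : ι → Space d} {S : Set (Set ι)}
    (hS : IsSubdivision A S) {F G : Set ι} (hF : F ∈ S) (hG : G ∈ S) {x : Space d}
    (hx : x ∈ intrinsicInterior ℝ (hull A F)) (hx' : x ∈ hull A G) : WeakFace A F G := by
  obtain ⟨G', hG', h⟩ := exists_weakFace_intrinsicInterior A G hx'
  by_cases he : F = G'
  · rwa [he]
  · have := hS.disjoint_relint F hF G' (hS.weakFace_mem hG hG') he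
    exact absurd (show x ∈ (∅ : Set (Space d)) from this ▸ ⟨hx, h⟩) (Set.notMem_empty x)

theorem IsSubdivision.mem_of_mem_hull [Finite ι] {A : ι → Space d} {S : Set (Set ι)}
    (hS : IsSubdivision A S) {F G : Set ι} (hF : F ∈ S) (hG : G ∈ S) {i : ι} (hi : i ∈ F)
    (hx : A i ∈ hull A G) : i ∈ G := by
  obtain ⟨F', hF', h⟩ := exists_weakFace_intrinsicInterior A F (mem_hull A hi)
  exact (hS.weakFace_of_mem (hS.weakFace_mem hF hF') hG h hx).subset
    (hF'.mem_of_mem_hull hi (intrinsicInterior_subset h))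

theorem IsSubdivision.mem_hull_of_openSegment [Finite ι] {A : ι → Space d} {S : Set (Set ι)}
    (hS : IsSubdivision A S) {F G : Set ι} (hF : F ∈ S) (hG : G ∈ S) {x y m : Space d}
    (hx : x ∈ hull A F) (hy : y ∈ hull A F) (hm : m ∈ hull A G)
    (hmxy : m ∈ openSegment ℝ x y) : x ∈ hull A G ∧ y ∈ hull A G := by
  have hmF : m ∈ hull A F := (convex_hull A F).openSegment_subset hx hy hmxy
  obtain ⟨F', hF', h⟩ := exists_weakFace_intrinsicInterior A F hmF
  have h1 := hull_mono A (hS.weakFace_of_mem (hS.weakFace_mem hF hF') hG h hm).subset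
  have h2 := hF'.mem_hull_of_openSegment hx hy (intrinsicInterior_subset h) hmxy
  exact ⟨h1 h2.1, h1 h2.2⟩

theorem IsSubdivision.eq_of_mem_interior [Finite ι] {A : ι → Space d} {S : Set (Set ι)}
    (hS : IsSubdivision A S) {F G : Set ι} (hF : F ∈ S) (hG : G ∈ S) {x : Space d}
    (hx : x ∈ interior (hull A F)) (hx' : x ∈ interior (hull A G)) : F = G := by
  by_contra he
  have := hS.disjoint_relint F hF G hG he
  exact absurd (show x ∈ (∅ : Set (Space d)) from this ▸ ⟨interior_subset_intrinsicInterior hx,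
    interior_subset_intrinsicInterior hx'⟩) (Set.notMem_empty x)

theorem interior_hull_univ_nonempty {A : ι → Space d} (hA : affineSpan ℝ (Set.range A) = ⊤) :
    (interior (hull A Set.univ)).Nonempty := by
  rw [hull, interior_convexHull_nonempty_iff_affineSpan_eq_top, Set.image_univ, hA]

theorem subset_of_dense_interior {P K : Set (Space d)} (hP : Convex ℝ P)
    (hne : (interior P).Nonempty) (hK : IsClosed K) (h : interior P ⊆ K) : P ⊆ K :=
  calc P ⊆ closure P := subset_closure
    _ = closure (interior P) := (hP.closure_interior_eq_closure_of_nonempty_interior hne).symm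
    _ ⊆ K := closure_minimal h hK

theorem interior_biUnion_eq_empty {α X : Type*} [TopologicalSpace X] {N : Set α} (hN : N.Finite)
    {t : α → Set X} (hc : ∀ a ∈ N, IsClosed (t a)) (ht : ∀ a ∈ N, interior (t a) = ∅) :
    interior (⋃ a ∈ N, t a) = ∅ := by
  induction N, hN using Set.Finite.induction_on with
  | empty => simp
  | @insert a N _ _ ih =>
    rw [Set.biUnion_insert, Set.union_comm, interior_union_isClosed_of_interior_empty]
    · exact ih (fun b hb => hc b (Set.mem_insert_of_mem a hb))
        (fun b hb => ht b (Set.mem_insert_of_mem a hb))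
    · exact ‹N.Finite›.isClosed_biUnion fun b hb => hc b (Set.mem_insert_of_mem a hb)
    · exact ht a (Set.mem_insert a N)

/-- The members with empty interior have a union with empty interior, so the others already cover. A
relative interior point of `F` lies in one of them, which contains `F` and so equals it by
maximality. -/
theorem IsSubdivision.interior_nonempty [Finite ι] {A : ι → Space d}
    (hA : affineSpan ℝ (Set.range A) = ⊤) {S : Set (Set ι)}
    (hS : IsSubdivision A S) {F : Set ι} (hF : F ∈ maximalFaces S) :
    (interior (hull A F)).Nonempty := by
  have hF : Maximal (fun G => G ∈ S) F := hF
  have hfin : S.Finite := Set.toFinite S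
  let D : Set (Set ι) := {G | G ∈ S ∧ (interior (hull A G)).Nonempty}
  let N : Set (Set ι) := {G | G ∈ S ∧ ¬ (interior (hull A G)).Nonempty}
  have hK : IsClosed (⋃ G ∈ D, hull A G) :=
    (Set.toFinite D).isClosed_biUnion fun G _ => isClosed_hull A G
  have hNn : interior (⋃ G ∈ N, hull A G) = ∅ :=
    interior_biUnion_eq_empty (Set.toFinite N) (fun G _ => isClosed_hull A G)
      fun G hG => Set.not_nonempty_iff_eq_empty.1 hG.2
  have hcov : hull A Set.univ ⊆ ⋃ G ∈ D, hull A G := by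
    refine subset_of_dense_interior (convex_hull A _) (interior_hull_univ_nonempty hA) hK ?_
    intro x hx
    by_contra hxK
    have hU : IsOpen (interior (hull A Set.univ) \ ⋃ G ∈ D, hull A G) :=
      isOpen_interior.sdiff hK
    have hUN : interior (hull A Set.univ) \ ⋃ G ∈ D, hull A G ⊆ ⋃ G ∈ N, hull A G := by
      rintro y ⟨hy, hy'⟩
      have := interior_subset hy
      rw [hS.hull_eq] at this
      simp only [Set.mem_iUnion, exists_prop] at this hy' ⊢
      obtain ⟨G, hG, hyG⟩ := this
      exact ⟨G, ⟨hG, fun h => hy' ⟨G, ⟨hG, h⟩, hyG⟩⟩, hyG⟩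
    have := interior_maximal hUN hU ⟨hx, hxK⟩
    rw [hNn] at this
    exact this
  obtain ⟨x, hx⟩ := Set.Nonempty.intrinsicInterior (convex_hull A F)
    (by obtain ⟨i, hi⟩ := hS.nonempty_of_mem F hF.prop; exact ⟨_, mem_hull A hi⟩)
  have hxP := hcov (hull_mono A (Set.subset_univ F) (intrinsicInterior_subset hx))
  simp only [Set.mem_iUnion, exists_prop] at hxP
  obtain ⟨G, ⟨hG, hGi⟩, hxG⟩ := hxP
  have h1 := (hS.weakFace_of_mem hF.prop hG hx hxG).subset
  rwa [hF.eq_of_subset hG h1]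

theorem IsSubdivision.exists_maximal [Finite ι] {A : ι → Space d} {S : Set (Set ι)}
    (_ : IsSubdivision A S) {F : Set ι} (hF : F ∈ S) : ∃ G ∈ maximalFaces S, F ⊆ G := by
  obtain ⟨G, hFG, hG⟩ := (Set.toFinite S).exists_le_maximal hF
  exact ⟨G, hG, hFG⟩

theorem IsSubdivision.hull_subset_maximal [Finite ι] {A : ι → Space d} {S : Set (Set ι)}
    (hS : IsSubdivision A S) : hull A Set.univ ⊆ ⋃ F ∈ maximalFaces S, hull A F := by
  intro x hx
  rw [hS.hull_eq] at hx
  simp only [Set.mem_iUnion, exists_prop] at hx ⊢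
  obtain ⟨F, hF, hxF⟩ := hx
  obtain ⟨G, hG, hFG⟩ := hS.exists_maximal hF
  exact ⟨G, hG, hull_mono A hFG hxF⟩

theorem IsSubdivision.mem_iff [Finite ι] {A : ι → Space d} {S : Set (Set ι)}
    (hS : IsSubdivision A S) (F : Set ι) : F ∈ S ↔ ∃ G ∈ maximalFaces S, WeakFace A F G := by
  constructor
  · intro hF
    obtain ⟨G, hG, hFG⟩ := hS.exists_maximal hF
    obtain ⟨x, hx⟩ := Set.Nonempty.intrinsicInterior (convex_hull A F)
      (by obtain ⟨i, hi⟩ := hS.nonempty_of_mem F hF; exact ⟨_, mem_hull A hi⟩)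
    exact ⟨G, hG, hS.weakFace_of_mem hF hG.prop hx
      (hull_mono A hFG (intrinsicInterior_subset hx))⟩
  · rintro ⟨G, hG, h⟩
    exact hS.weakFace_mem hG.prop h

/-! ### Regular subdivisions -/

/-- Bounded faces are those exposed by a functional strictly decreasing in the vertical direction;
normalised, it is the graph of an affine minorant of `w`, and the face records where the minorant is
tight. -/
theorem mem_regularSubdivision_iff [Finite ι] {A : ι → Space d} {w : ι → ℝ} {F : Set ι} :
    F ∈ regularSubdivision A w ↔
      F.Nonempty ∧ ∃ g : Space d →ᵃ[ℝ] ℝ, (∀ i, g (A i) ≤ w i) ∧ F = {i | g (A i) = w i} := by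
  have hlift : ∀ i, (w i, A i) ∈ lift A w := fun i =>
    ⟨_, subset_convexHull ℝ _ ⟨i, rfl⟩, 0, le_rfl, by simp⟩
  constructor
  · rintro ⟨G, hG, hne, hb, rfl⟩
    obtain ⟨l, hl⟩ := hG hne
    obtain ⟨p, hp⟩ := hne
    have hp' := hp
    rw [hl] at hp
    obtain ⟨hpl, hmax⟩ := hp
    set α := l (1, 0) with hα
    let β : Space d →ₗ[ℝ] ℝ := l.toLinearMap.comp (LinearMap.inr ℝ ℝ (Space d))
    have hlαβ : ∀ (t : ℝ) (x : Space d), l (t, x) = t * α + β x := fun t x => by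
      have : (t, x) = t • ((1 : ℝ), (0 : Space d)) + ((0 : ℝ), x) := by simp
      rw [this, map_add, map_smul]; simp [hα, β]
    have hup : ∀ q ∈ lift A w, ∀ s : ℝ, 0 ≤ s → (q.1 + s, q.2) ∈ lift A w := by
      rintro _ ⟨r, hr, t, ht, rfl⟩ s hs
      exact ⟨r, hr, t + s, by positivity, by simp [add_assoc]⟩
    -- If `α` were zero, `G` would contain the vertical ray above `p` and be unbounded.
    have hαneg : α < 0 := by
      have h1 : ∀ s : ℝ, 0 ≤ s → s * α ≤ 0 := fun s hs => by
        have := hmax _ (hup p hpl s hs)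
        rw [hlαβ, ← Prod.mk.eta (p := p), hlαβ] at this
        linarith
      refine lt_of_le_of_ne (by simpa using h1 1 zero_le_one) fun h0 => ?_
      obtain ⟨R, hR⟩ := hb.exists_norm_le
      have h2 : (p.1 + (|R| + |p.1| + 1), p.2) ∈ G := by
        rw [hl]
        refine ⟨hup p hpl _ (by positivity), fun y hy => ?_⟩
        have := hmax y hy
        rw [← Prod.mk.eta (p := p), hlαβ p.1] at this
        rw [← Prod.mk.eta (p := y), hlαβ] at this ⊢
        rw [hlαβ]
        simpa [h0] using this
      have h3 := hR _ h2
      have h4 := (norm_fst_le _).trans h3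
      simp only [Real.norm_eq_abs] at h4
      have h5 := (abs_le.1 h4).2
      have h6 := neg_abs_le p.1
      have h7 := le_abs_self R
      linarith
    have hmem : ∀ i, (w i, A i) ∈ G ↔ l (w i, A i) = l p := by
      intro i
      rw [hl]
      exact ⟨fun h => le_antisymm (hmax _ (hlift i)) (h.2 p hpl),
        fun h => ⟨hlift i, fun y hy => (hmax y hy).trans h.ge⟩⟩
    refine ⟨?_, α⁻¹ • (AffineMap.const ℝ (Space d) (l p) - β.toAffineMap), fun i => ?_, ?_⟩
    · by_contra hemp
      have hlt : ∀ i, l (w i, A i) < l p := fun i =>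
        lt_of_le_of_ne (hmax _ (hlift i)) fun h => hemp ⟨i, (hmem i).2 h⟩
      obtain ⟨r, hr, t, ht, hprt⟩ := hpl
      have h1 : convexHull ℝ (Set.range fun i => (w i, A i)) ⊆ {q | l q < l p} :=
        convexHull_min (by rintro _ ⟨i, rfl⟩; exact hlt i)
          ((convex_Iio (l p)).linear_preimage l.toLinearMap)
      have h2 : l r < l p := h1 hr
      rw [hprt, hlαβ, ← Prod.mk.eta (p := r), hlαβ] at h2
      nlinarith
    · have := hmax _ (hlift i)
      rw [hlαβ] at this
      simp
      rw [inv_mul_eq_div, div_le_iff_of_neg hαneg]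
      linarith
    · ext i
      rw [Set.mem_ofPred_eq, hmem, Set.mem_ofPred_eq, hlαβ]
      simp
      rw [inv_mul_eq_iff_eq_mul₀ hαneg.ne]
      constructor <;> intro h <;> linarith
  · rintro ⟨⟨j, hj⟩, g, hg, rfl⟩
    have hge : ∀ q ∈ convexHull ℝ (Set.range fun i => (w i, A i)), g q.2 ≤ q.1 := by
      have : convexHull ℝ (Set.range fun i => (w i, A i)) ⊆ {q | g q.2 ≤ q.1} := by
        refine convexHull_min (by rintro _ ⟨i, rfl⟩; exact hg i) ?_
        rintro p hp q hq a b ha hb hab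
        have e : g (a • p.2 + b • q.2) = a * g p.2 + b * g q.2 := by
          simpa using Convex.combo_affine_apply (f := g) (x := p.2) (y := q.2) hab
        have hp : g p.2 ≤ p.1 := hp
        have hq : g q.2 ≤ q.1 := hq
        change g (a • p.2 + b • q.2) ≤ a * p.1 + b * q.1
        rw [e]
        gcongr
      exact this
    have hgl : ∀ q ∈ lift A w, g q.2 ≤ q.1 := by
      rintro _ ⟨r, hr, t, ht, rfl⟩
      have := hge r hr
      simp; linarith
    have hj : g (A j) = w j := hj
    refine ⟨{p | p ∈ lift A w ∧ p.1 = g p.2}, fun _ => ?_, ⟨_, hlift j, hj.symm⟩, ?_, ?_⟩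
    · let l : ℝ × Space d →ₗ[ℝ] ℝ :=
        g.linear.comp (LinearMap.snd ℝ ℝ (Space d)) - LinearMap.fst ℝ ℝ (Space d)
      have hl : ∀ p, l p = g p.2 - g 0 - p.1 := fun p => by
        have := g.linearMap_vsub p.2 0
        simp only [vsub_eq_sub, sub_zero] at this
        simp [l, this]
      refine ⟨LinearMap.toContinuousLinearMap l, ?_⟩
      ext p
      simp only [Set.mem_ofPred_eq, LinearMap.coe_toContinuousLinearMap', hl]
      refine and_congr_right fun hp => ⟨fun h q hq => ?_, fun h => ?_⟩
      · have := hgl q hq; linarith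
      · have h1 := h _ (hlift j)
        have h2 := hgl p hp
        simp [hj] at h1
        linarith
    · have hb : Bornology.IsBounded (convexHull ℝ (Set.range fun i => (w i, A i))) :=
        isBounded_convexHull.2 (Set.finite_range _).isBounded
      refine hb.subset ?_
      rintro _ ⟨⟨r, hr, t, ht, rfl⟩, h⟩
      have := hge r hr
      simp at h
      obtain rfl : t = 0 := by linarith
      simpa using hr
    · ext i
      simp [hlift i, eq_comm]

theorem regularSubdivision_isFace_mem [Finite ι] {A : ι → Space d} {w : ι → ℝ} {F G : Set ι}
    (hF : F ∈ regularSubdivision A w) (hG : WeakFace A G F) : G ∈ regularSubdivision A w := by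
  rw [mem_regularSubdivision_iff] at hF ⊢
  obtain ⟨-, g, hg, rfl⟩ := hF
  obtain ⟨hne, q, hq, rfl⟩ := hG
  obtain ⟨ε, -, h1, h2⟩ := exists_perturbation Set.univ (fun i => w i - g (A i))
    (fun i => q (A i)) (fun i _ => by simpa using hg i)
    (fun i _ h0 => hq i (by simp at h0 ⊢; linarith))
  refine ⟨hne, g - ε • q, fun i => ?_, ?_⟩
  · have := h1 i trivial
    simp; linarith
  · ext i
    have := h2 i trivial
    simp only [Set.mem_ofPred_eq]
    have e : (g - ε • q) (A i) = g (A i) - ε * q (A i) := by simp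
    rw [e]
    constructor
    · rintro ⟨a, b⟩
      rw [a, b]; ring
    · intro h
      have := this.1 (by linarith)
      exact ⟨by linarith, this.2⟩

/-- For disjointness: two minorants agree wherever both tight hulls meet, and at a relative interior
point of one of them the agreement spreads over that whole hull. -/
theorem isSubdivision_regularSubdivision [Finite ι] {A : ι → Space d} {w : ι → ℝ}
    (hc : hull A Set.univ ⊆ ⋃ F ∈ regularSubdivision A w, hull A F) :
    IsSubdivision A (regularSubdivision A w) where
  nonempty_of_mem F hF := (mem_regularSubdivision_iff.1 hF).1
  face_mem F hF G hG := regularSubdivision_isFace_mem hF (weakFace_of_isFace hG)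
  hull_eq := hc.antisymm (Set.iUnion₂_subset fun F _ => hull_mono A (Set.subset_univ F))
  disjoint_relint := by
    have key : ∀ F ∈ regularSubdivision A w, ∀ G ∈ regularSubdivision A w,
        (intrinsicInterior ℝ (hull A F) ∩ intrinsicInterior ℝ (hull A G)).Nonempty → F ⊆ G := by
      rintro F hF G hG ⟨x, hxF, hxG⟩
      obtain ⟨-, f, hf, rfl⟩ := mem_regularSubdivision_iff.1 hF
      obtain ⟨-, g, hg, rfl⟩ := mem_regularSubdivision_iff.1 hG
      have h1 : ∀ y ∈ hull A {i | f (A i) = w i}, 0 ≤ (f - g) y := fun y hy =>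
        nonneg_on_hull (fun i hi => by have := hg i; have : f (A i) = w i := hi; simp; linarith) hy
      have h2 : ∀ y ∈ hull A {i | g (A i) = w i}, 0 ≤ (g - f) y := fun y hy =>
        nonneg_on_hull (fun i hi => by have := hf i; have : g (A i) = w i := hi; simp; linarith) hy
      have h3 := h1 x (intrinsicInterior_subset hxF)
      have h4 := h2 x (intrinsicInterior_subset hxG)
      intro i hi
      have h5 := zero_of_intrinsicInterior h1 hxF
        (by simp at h3 h4 ⊢; linarith) _ (mem_hull A hi)
      have hi : f (A i) = w i := hi
      simp at h5 ⊢
      linarith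
    intro F hF G hG hne
    by_contra h
    have h := Set.nonempty_iff_ne_empty.2 h
    exact hne ((key F hF G hG h).antisymm (key G hG F hF (by rwa [Set.inter_comm])))

/-- A relative interior point of a tight set for `g` lies in some `F j`; there `g` and `f j` agree,
so `f j - g` cuts that tight set out of `F j`. -/
theorem regularSubdivision_eq [Finite ι] {J : Type*} {A : ι → Space d} {w : ι → ℝ}
    {F : J → Set ι} {f : J → Space d →ᵃ[ℝ] ℝ} (hne : ∀ j, (F j).Nonempty)
    (hc : hull A Set.univ ⊆ ⋃ j, hull A (F j)) (hle : ∀ j i, f j (A i) ≤ w i)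
    (hF : ∀ j, F j = {i | f j (A i) = w i}) :
    regularSubdivision A w = {G | ∃ j, WeakFace A G (F j)} := by
  ext G
  constructor
  · intro hG
    obtain ⟨hGne, g, hg, rfl⟩ := mem_regularSubdivision_iff.1 hG
    obtain ⟨x, hx⟩ := Set.Nonempty.intrinsicInterior (convex_hull A {i | g (A i) = w i})
      (by obtain ⟨i, hi⟩ := hGne; exact ⟨_, mem_hull A hi⟩)
    have hx' := hc (hull_mono A (Set.subset_univ _) (intrinsicInterior_subset hx))
    rw [Set.mem_iUnion] at hx'
    obtain ⟨j, hj⟩ := hx'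
    have hwj : ∀ i ∈ F j, 0 ≤ (f j - g) (A i) := fun i hi => by
      rw [hF j] at hi
      have h1 : f j (A i) = w i := hi
      have := hg i
      simp; linarith
    have h1 : ∀ y ∈ hull A {i | g (A i) = w i}, 0 ≤ (g - f j) y := fun y hy =>
      nonneg_on_hull (fun i hi => by
        have h1 : g (A i) = w i := hi
        have := hle j i
        simp; linarith) hy
    have h2 := nonneg_on_hull hwj hj
    have h3 := h1 x (intrinsicInterior_subset hx)
    have h4 := zero_of_intrinsicInterior h1 hx (by simp at h2 h3 ⊢; linarith)
    refine ⟨j, hGne, f j - g, hwj, ?_⟩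
    ext i
    rw [hF j]
    constructor
    · intro hi
      have h5 := h4 _ (mem_hull A hi)
      have hi : g (A i) = w i := hi
      simp at h5 ⊢
      constructor <;> linarith
    · rintro ⟨h5, h6⟩
      simp at h5 h6 ⊢
      linarith
  · rintro ⟨j, hj⟩
    refine regularSubdivision_isFace_mem (mem_regularSubdivision_iff.2 ⟨hne j, f j, hle j, hF j⟩) hj

/-- The cells `F j` are the sets of used labels on which the affine function `f j` is maximal. -/
structure MaxCells {J : Type*} (A : ι → Space d) (F : J → Set ι) (f : J → Space d →ᵃ[ℝ] ℝ) :
    Prop where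
  nonempty : ∀ j, (F j).Nonempty
  cover : hull A Set.univ ⊆ ⋃ j, hull A (F j)
  le : ∀ j k, ∀ i ∈ F j, f k (A i) ≤ f j (A i)
  mem : ∀ j k, ∀ i ∈ F k, f k (A i) ≤ f j (A i) → i ∈ F j

theorem MaxCells.exists_weight [Finite ι] {J : Type*} [Finite J] [Nonempty J] {A : ι → Space d}
    {F : J → Set ι} {f : J → Space d →ᵃ[ℝ] ℝ} (h : MaxCells A F f) :
    ∃ w : ι → ℝ, regularSubdivision A w = {G | ∃ j, WeakFace A G (F j)} ∧
      IsSubdivision A (regularSubdivision A w) := by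
  classical
  -- Labels used by no cell are raised strictly above the envelope, so that no `f j` is tight there.
  let w : ι → ℝ := fun i => (⨆ j, f j (A i)) + if i ∈ ⋃ j, F j then 0 else 1
  have hsup : ∀ j i, f j (A i) ≤ ⨆ j, f j (A i) := fun j i =>
    le_ciSup (f := fun j => f j (A i)) (Set.finite_range _).bddAbove j
  have hle : ∀ j i, f j (A i) ≤ w i := fun j i => by
    have := hsup j i
    dsimp only [w]
    split_ifs <;> linarith
  have hF : ∀ j, F j = {i | f j (A i) = w i} := fun j => by
    ext i
    constructor
    · intro hi
      refine le_antisymm (hle j i) ?_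
      have : i ∈ ⋃ j, F j := Set.mem_iUnion.2 ⟨j, hi⟩
      simp only [w, this, if_true, add_zero]
      exact ciSup_le fun k => h.le j k i hi
    · intro hi
      have hi : f j (A i) = w i := hi
      have h1 := hsup j i
      by_cases hU : i ∈ ⋃ j, F j
      · obtain ⟨k, hk⟩ := Set.mem_iUnion.1 hU
        simp only [w, hU, if_true, add_zero] at hi
        exact h.mem j k i hk (hi ▸ hsup k i)
      · simp only [w, hU, if_false] at hi
        linarith
  have hreg := regularSubdivision_eq h.nonempty h.cover hle hF
  refine ⟨w, hreg, isSubdivision_regularSubdivision (h.cover.trans ?_)⟩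
  rw [hreg]
  exact Set.iUnion_subset fun j => Set.subset_biUnion_of_mem (u := fun G => hull A G)
    (show F j ∈ {G | ∃ j, WeakFace A G (F j)} from ⟨j, WeakFace.refl A (h.nonempty j)⟩)

/-! ### Convex geometry of the maximal cells -/

theorem eventually_lineMap_mem {s : Set (Space d)} {x : Space d} (hx : x ∈ interior s)
    (y : Space d) : ∀ᶠ t in nhds (0 : ℝ), AffineMap.lineMap x y t ∈ s := by
  have h : Filter.Tendsto (fun t : ℝ => AffineMap.lineMap x y t) (nhds 0) (nhds x) := by
    have := (AffineMap.lineMap_continuous (R := ℝ) (p := x) (q := y)).tendsto 0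
    simpa using this
  exact h.eventually (mem_interior_iff_mem_nhds.1 hx)

theorem exists_pos_lineMap_neg_mem {s : Set (Space d)} {x : Space d} (hx : x ∈ interior s)
    (y : Space d) : ∃ ε : ℝ, 0 < ε ∧ AffineMap.lineMap x y (-ε) ∈ s := by
  have h : Filter.Tendsto (fun t : ℝ => -t) (nhds 0) (nhds 0) := by
    simpa using (continuous_neg (G := ℝ)).tendsto 0
  have h1 : ∀ᶠ t in nhdsWithin (0 : ℝ) (Set.Ioi 0), AffineMap.lineMap x y (-t) ∈ s :=
    nhdsWithin_le_nhds (h.eventually (eventually_lineMap_mem hx y))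
  obtain ⟨ε, h2, h3⟩ := (h1.and self_mem_nhdsWithin).exists
  exact ⟨ε, h3, h2⟩

theorem mem_openSegment_lineMap_neg (x y : Space d) {ε : ℝ} (hε : 0 < ε) :
    x ∈ openSegment ℝ y (AffineMap.lineMap x y (-ε)) := by
  refine ⟨ε / (1 + ε), 1 / (1 + ε), by positivity, by positivity, by field_simp; ring, ?_⟩
  rw [AffineMap.lineMap_apply_module, smul_add, smul_smul, smul_smul, add_left_comm, ← add_smul]
  have h1 : ε / (1 + ε) + 1 / (1 + ε) * -ε = 0 := by field_simp; ring
  have h2 : 1 / (1 + ε) * (1 - -ε) = 1 := by field_simp; ring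
  rw [h1, h2]; simp

theorem mem_of_eventually_lineMap {K : Set (Space d)} (hK : IsClosed K) {x y : Space d}
    (h : ∀ᶠ t in nhdsWithin (0 : ℝ) (Set.Ioi 0), AffineMap.lineMap x y t ∈ K) : x ∈ K := by
  have h1 : Filter.Tendsto (fun t : ℝ => AffineMap.lineMap x y t)
      (nhdsWithin (0 : ℝ) (Set.Ioi 0)) (nhds x) := by
    have := (AffineMap.lineMap_continuous (R := ℝ) (p := x) (q := y)).tendsto 0
    simp only [AffineMap.lineMap_apply_zero] at this
    exact this.mono_left nhdsWithin_le_nhds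
  exact hK.mem_of_tendsto h1 h

theorem eq_zero_of_interior {s : Set (Space d)} {g : Space d →ᵃ[ℝ] ℝ} (hg : ∀ y ∈ s, 0 ≤ g y)
    {x : Space d} (hx : x ∈ interior s) (h0 : g x = 0) (y : Space d) : g y = 0 := by
  obtain ⟨ε, he, h⟩ := exists_pos_lineMap_neg_mem hx y
  obtain ⟨δ, hd, h'⟩ := exists_pos_lineMap_neg_mem hx (AffineMap.lineMap x y (-1 : ℝ))
  have h1 := hg _ h
  have h2 := hg _ h'
  simp only [affine_lineMap, h0] at h1 h2
  have h3 : 0 ≤ ε * -(g y) := by linarith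
  have h4 : 0 ≤ δ * g y := by linarith
  have h5 := nonneg_of_mul_nonneg_right h3 he
  have h6 := nonneg_of_mul_nonneg_right h4 hd
  linarith

theorem exists_zero_of_sign {s : Set (Space d)} (hs : Convex ℝ s) {g : Space d →ᵃ[ℝ] ℝ}
    {p q : Space d} (hp : p ∈ s) (hq : q ∈ s) (hgp : g p < 0) (hgq : 0 < g q) :
    ∃ z ∈ s, g z = 0 := by
  have hne : g q - g p ≠ 0 := by linarith
  have hpos : 0 < g q - g p := by linarith
  refine ⟨AffineMap.lineMap p q (-g p / (g q - g p)),
    hs.lineMap_mem hp hq ⟨div_nonneg (by linarith) hpos.le, ?_⟩, ?_⟩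
  · rw [div_le_one hpos]; linarith
  · rw [affine_lineMap]; field_simp; ring

theorem apply_eq_sum {n : Type*} [Fintype n] [DecidableEq n] (m : (n → ℝ) →ₗ[ℝ] ℝ) (v : n → ℝ) :
    m v = ∑ j, v j * m (Pi.single j 1) := by
  conv_lhs => rw [← Finset.univ_sum_single v]
  rw [map_sum]
  refine Finset.sum_congr rfl fun j _ => ?_
  have : Pi.single j (v j) = v j • (Pi.single j (1 : ℝ) : n → ℝ) := by
    rw [← Pi.single_smul]; simp
  rw [this, map_smul, smul_eq_mul]

/-- The hyperplane `h = 0` weakly separates the convex hulls of `F` and `G`. -/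
structure Separates (A : ι → Space d) (h : Space d →ᵃ[ℝ] ℝ) (F G : Set ι) : Prop where
  nonpos : ∀ x ∈ hull A F, h x ≤ 0
  nonneg : ∀ x ∈ hull A G, 0 ≤ h x
  ne_zero : ∃ y, h y ≠ 0

namespace Separates

variable {A : ι → Space d} {h : Space d →ᵃ[ℝ] ℝ} {F G : Set ι}

theorem neg (s : Separates A h F G) : Separates A (-h) G F where
  nonpos x hx := by simpa using s.nonneg x hx
  nonneg x hx := by simpa using s.nonpos x hx
  ne_zero := by simpa using s.ne_zero

theorem smul (s : Separates A h F G) {c : ℝ} (hc : 0 < c) : Separates A (c • h) F G where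
  nonpos x hx := by simpa using mul_nonpos_of_nonneg_of_nonpos hc.le (s.nonpos x hx)
  nonneg x hx := by simpa using mul_nonneg hc.le (s.nonneg x hx)
  ne_zero := by
    obtain ⟨y, hy⟩ := s.ne_zero
    exact ⟨y, by simp [hc.ne', hy]⟩

theorem pos (s : Separates A h F G) {x : Space d} (hx : x ∈ interior (hull A G)) : 0 < h x := by
  refine lt_of_le_of_ne (s.nonneg x (interior_subset hx)) fun h0 => ?_
  obtain ⟨y, hy⟩ := s.ne_zero
  exact hy (eq_zero_of_interior s.nonneg hx h0.symm y)

theorem neg_of_interior (s : Separates A h F G) {x : Space d} (hx : x ∈ interior (hull A F)) :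
    h x < 0 := by
  have := s.neg.pos hx
  simpa using this

end Separates

/-- `F` enumerates the maximal faces of the subdivision `S` of the full-dimensional
configuration `A`. -/
structure Cells {J : Type*} (A : ι → Space d) (S : Set (Set ι)) (F : J → Set ι) : Prop where
  sub : IsSubdivision A S
  injective : Function.Injective F
  range_eq : Set.range F = maximalFaces S
  affineSpan_eq : affineSpan ℝ (Set.range A) = ⊤

namespace Cells

variable {A : ι → Space d} {S : Set (Set ι)}

section General

variable {J : Type*} {F : J → Set ι}

theorem comp (C : Cells A S F) {J' : Type*} (σ : J' ≃ J) : Cells A S (F ∘ σ) where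
  sub := C.sub
  injective := C.injective.comp σ.injective
  range_eq := by rw [Set.range_comp, σ.range_eq_univ, Set.image_univ, C.range_eq]
  affineSpan_eq := C.affineSpan_eq

theorem maximal (C : Cells A S F) (j : J) : F j ∈ maximalFaces S := C.range_eq ▸ ⟨j, rfl⟩

theorem mem (C : Cells A S F) (j : J) : F j ∈ S := (C.maximal j).prop

variable [Finite ι]

theorem mem_iff (C : Cells A S F) {G : Set ι} : G ∈ S ↔ ∃ j, WeakFace A G (F j) := by
  rw [C.sub.mem_iff, ← C.range_eq]; simp

theorem interior_nonempty (C : Cells A S F) (j : J) : (interior (hull A (F j))).Nonempty :=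
  C.sub.interior_nonempty C.affineSpan_eq (C.maximal j)

theorem cover (C : Cells A S F) : hull A Set.univ ⊆ ⋃ j, hull A (F j) := by
  have := C.sub.hull_subset_maximal
  rwa [← C.range_eq, Set.biUnion_range] at this

theorem exists_mem (C : Cells A S F) {x : Space d} (hx : x ∈ hull A Set.univ) :
    ∃ j, x ∈ hull A (F j) := Set.mem_iUnion.1 (C.cover hx)

theorem subset_closed (C : Cells A S F) {j : J} {K : Set (Space d)} (hK : IsClosed K)
    (h : interior (hull A (F j)) ⊆ K) : hull A (F j) ⊆ K :=
  subset_of_dense_interior (convex_hull A _) (C.interior_nonempty j) hK h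

theorem disjoint (C : Cells A S F) {j k : J} (hjk : j ≠ k) :
    Disjoint (interior (hull A (F j))) (hull A (F k)) := by
  rw [Set.disjoint_left]
  intro x hx hxk
  refine (C.subset_closed (j := k) isOpen_interior.isClosed_compl fun y hy hyj => ?_) hxk hx
  exact hjk (C.injective (C.sub.eq_of_mem_interior (C.mem j) (C.mem k) hyj hy))

theorem exists_separates (C : Cells A S F) {j k : J} (hjk : j ≠ k) :
    ∃ h, Separates A h (F j) (F k) := by
  obtain ⟨f, u, h1, h2⟩ := geometric_hahn_banach_open (convex_hull A (F j)).interior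
    isOpen_interior (convex_hull A (F k)) (C.disjoint hjk)
  have he : ∀ x, (f.toLinearMap.toAffineMap - AffineMap.const ℝ (Space d) u) x = f x - u :=
    fun x => by simp
  refine ⟨f.toLinearMap.toAffineMap - AffineMap.const ℝ _ u, fun x hx => ?_, fun x hx => ?_, ?_⟩
  · rw [he]
    exact C.subset_closed (j := j) (K := {x | f x - u ≤ 0})
      (isClosed_le (f.continuous.sub continuous_const) continuous_const)
      (fun y hy => by have := h1 y hy; simp; linarith) hx
  · rw [he]; have := h2 x hx; linarith
  · obtain ⟨y, hy⟩ := C.interior_nonempty j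
    exact ⟨y, by rw [he]; have := h1 y hy; linarith⟩

/-- Moving `x` slightly towards an interior point of cell `i` makes every separator negative, so the
moved point can lie in no other cell; then pass to the limit. -/
theorem mem_hull_of_nonpos (C : Cells A S F) {i : J} {h : J → Space d →ᵃ[ℝ] ℝ}
    (hs : ∀ k, k ≠ i → Separates A (h k) (F i) (F k)) {x : Space d} (hx : x ∈ hull A Set.univ)
    (hx0 : ∀ k, k ≠ i → h k x ≤ 0) : x ∈ hull A (F i) := by
  obtain ⟨p, hp⟩ := C.interior_nonempty i
  have hpP := hull_mono A (Set.subset_univ _) (interior_subset hp)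
  refine mem_of_eventually_lineMap (isClosed_hull A (F i)) (y := p) ?_
  filter_upwards [Ioo_mem_nhdsGT (zero_lt_one' ℝ)] with t ht
  obtain ⟨j, hj⟩ := C.exists_mem ((convex_hull A Set.univ).lineMap_mem hx hpP ⟨ht.1.le, ht.2.le⟩)
  by_cases hji : j = i
  · rwa [hji] at hj
  · have h1 := (hs j hji).nonneg _ hj
    rw [affine_lineMap] at h1
    have h2 := (hs j hji).neg_of_interior hp
    have h3 := hx0 j hji
    have := ht.1
    have := ht.2
    nlinarith

/-- Affine functions, one for each cell, whose differences separate the cells. -/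
def Coherent (A : ι → Space d) (F : J → Set ι) (f : J → Space d →ᵃ[ℝ] ℝ) : Prop :=
  ∀ j k, j ≠ k → Separates A (f k - f j) (F j) (F k)

theorem maxCells (C : Cells A S F) {f : J → Space d →ᵃ[ℝ] ℝ} (hf : Coherent A F f) :
    MaxCells A F f where
  nonempty j := C.sub.nonempty_of_mem _ (C.mem j)
  cover := C.cover
  le j k i hi := by
    by_cases hjk : j = k
    · rw [hjk]
    · have := (hf j k hjk).nonpos _ (mem_hull A hi)
      simpa using this
  mem j k i hi hle := by
    refine C.sub.mem_of_mem_hull (C.mem k) (C.mem j) hi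
      (C.mem_hull_of_nonpos (h := fun m => f m - f j) (fun m hm => hf j m hm.symm)
        (mem_hull A (Set.mem_univ i)) fun m _ => ?_)
    by_cases hkm : k = m
    · subst hkm; simpa using hle
    · have := (hf k m hkm).nonpos _ (mem_hull A hi)
      simp at this ⊢
      linarith

theorem isRegular [Finite J] [Nonempty J] (C : Cells A S F) {f : J → Space d →ᵃ[ℝ] ℝ}
    (hf : Coherent A F f) : IsRegular A S := by
  obtain ⟨w, hw, -⟩ := (C.maxCells hf).exists_weight
  refine ⟨w, ?_⟩
  rw [hw]
  ext G
  exact C.mem_iff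

end General

/-! ### Three cells -/

variable {F : Fin 3 → Set ι}

theorem coherent_of {f : Fin 3 → Space d →ᵃ[ℝ] ℝ} (h01 : Separates A (f 1 - f 0) (F 0) (F 1))
    (h12 : Separates A (f 2 - f 1) (F 1) (F 2)) (h02 : Separates A (f 2 - f 0) (F 0) (F 2)) :
    Coherent A F f := by
  have h10 := h01.neg
  have h21 := h12.neg
  have h20 := h02.neg
  rw [neg_sub] at h10 h21 h20
  intro j k hjk
  fin_cases j <;> fin_cases k <;> first | exact absurd rfl hjk | assumption

/-- Some cell is cut off from the others by a hyperplane. -/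
def CutOff (A : ι → Space d) (F : Fin 3 → Set ι) : Prop :=
  ∃ i h, ∀ k, k ≠ i → Separates A h (F i) (F k)

variable [Finite ι]

/-- With `k` separating cells 1 and 2, the tilt `h + ε k` must stay nonpositive on cell 0. Only
labels with `h = 0` are critical, and those lie in cell 1, where `k ≤ 0`. -/
theorem exists_coherent_of_mem (C : Cells A S F) {h : Space d →ᵃ[ℝ] ℝ}
    (h1 : Separates A h (F 0) (F 1)) (h2 : Separates A h (F 0) (F 2)) {y : Space d}
    (hy : y ∈ interior (hull A Set.univ)) (hy0 : h y = 0) (hy1 : y ∈ hull A (F 1)) :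
    ∃ f, Coherent A F f := by
  obtain ⟨k, hk⟩ := C.exists_separates (show (1 : Fin 3) ≠ 2 by decide)
  have hs : ∀ k : Fin 3, k ≠ 0 → Separates A h (F 0) (F k) := by
    intro k hk
    fin_cases k
    · exact absurd rfl hk
    · exact h1
    · exact h2
  -- Prolonging the segment from `A i` past `y` within the hyperplane stays in cell 0, so `y` is
  -- inside a segment of cell 0; as `y` is in cell 1, so are the endpoints.
  have hD : ∀ i ∈ F 0, h (A i) = 0 → A i ∈ hull A (F 1) := by
    intro i hi h0
    obtain ⟨ε, hε, hz⟩ := exists_pos_lineMap_neg_mem hy (A i)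
    have hz0 : h (AffineMap.lineMap y (A i) (-ε)) = 0 := by rw [affine_lineMap, hy0, h0]; ring
    exact (C.sub.mem_hull_of_openSegment (C.mem 0) (C.mem 1) (mem_hull A hi)
      (C.mem_hull_of_nonpos (h := fun _ => h) hs hz fun _ _ => hz0.le) hy1
      (mem_openSegment_lineMap_neg y (A i) hε)).1
  obtain ⟨ε, hε, hε', -⟩ := exists_perturbation (F 0) (fun i => -h (A i)) (fun i => -k (A i))
    (fun i hi => by simpa using h1.nonpos _ (mem_hull A hi))
    (fun i hi h0 => by simpa using hk.nonpos _ (hD i hi (by simpa using h0)))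
  refine ⟨![0, h, h + ε • k], coherent_of ?_ ?_ ?_⟩
  · simpa using h1
  · simpa using hk.smul hε
  · have e : ∀ x, (h + ε • k) x = h x + ε * k x := fun x => by simp
    simp only [Matrix.cons_val, sub_zero]
    refine ⟨fun x hx => ?_, fun x hx => ?_, ?_⟩
    · have := nonneg_on_hull (g := -(h + ε • k))
        (fun i hi => by have := hε' i hi; simp at this ⊢; linarith) hx
      simp at this
      rw [e]; linarith
    · rw [e]
      have := h2.nonneg x hx
      have := hk.nonneg x hx
      positivity
    · obtain ⟨p, hp⟩ := C.interior_nonempty 2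
      refine ⟨p, ?_⟩
      rw [e]
      have := h2.pos hp
      have := hk.nonneg p (interior_subset hp)
      positivity

theorem isRegular_of_cutOff (C : Cells A S F) (hc : CutOff A F) : IsRegular A S := by
  obtain ⟨i, h, hs⟩ := hc
  have C' := C.comp (Equiv.swap 0 i)
  set F' := F ∘ Equiv.swap 0 i with hF'
  have h0 : F' 0 = F i := by simp [hF']
  have hs' : ∀ k, k ≠ 0 → Separates A h (F' 0) (F' k) := fun k hk => by
    rw [h0]
    exact hs _ fun h => hk (by rwa [Equiv.swap_apply_eq_iff, Equiv.swap_apply_right] at h)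
  have h1 := hs' 1 (by decide)
  have h2 := hs' 2 (by decide)
  obtain ⟨p, hp⟩ := C'.interior_nonempty 0
  obtain ⟨q, hq⟩ := C'.interior_nonempty 1
  have hPi : ∀ j, interior (hull A (F' j)) ⊆ interior (hull A Set.univ) := fun j =>
    interior_mono (hull_mono A (Set.subset_univ _))
  obtain ⟨y, hy, hy0⟩ := exists_zero_of_sign (convex_hull A Set.univ).interior (hPi 0 hp)
    (hPi 1 hq) (h1.neg_of_interior hp) (h1.pos hq)
  -- Towards `q` the function `h` is positive, which excludes cell 0; whichever of the other two
  -- cells contains `y` takes the role of cell 1.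
  have hy12 : y ∈ hull A (F' 1) ∪ hull A (F' 2) := by
    refine mem_of_eventually_lineMap ((isClosed_hull A _).union (isClosed_hull A _)) (y := q) ?_
    filter_upwards [Ioo_mem_nhdsGT (zero_lt_one' ℝ)] with t ht
    obtain ⟨j, hj⟩ := C'.exists_mem ((convex_hull A Set.univ).lineMap_mem (interior_subset hy)
      (interior_subset (hPi 1 hq)) ⟨ht.1.le, ht.2.le⟩)
    fin_cases j
    · have h3 := h1.nonpos _ hj
      rw [affine_lineMap, hy0] at h3
      have h4 := mul_pos ht.1 (h1.pos hq)
      linarith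
    · exact Or.inl hj
    · exact Or.inr hj
  rcases hy12 with hy1 | hy2
  · obtain ⟨f, hf⟩ := C'.exists_coherent_of_mem h1 h2 hy hy0 hy1
    exact C'.isRegular hf
  · have C'' := C'.comp (Equiv.swap (1 : Fin 3) 2)
    obtain ⟨f, hf⟩ := C''.exists_coherent_of_mem (h := h) (y := y)
      (by simpa [Equiv.swap_apply_of_ne_of_ne] using h2)
      (by simpa [Equiv.swap_apply_of_ne_of_ne] using h1) hy hy0 (by simpa using hy2)
    exact C''.isRegular hf

/-- The slice of the open hull by a hyperplane separating cells `i` and `j` is connected and covered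
by two closed sets, `F i ∩ F j` and `F k`, disjoint in it by `hno`. The first contains `y`, so cell
`k` misses the slice. -/
theorem cutOff_of_mem_two (C : Cells A S F) {i j k : Fin 3} (hij : i ≠ j) (hik : i ≠ k)
    (hjk : j ≠ k) (hcov : ∀ m, m = i ∨ m = j ∨ m = k) {y : Space d}
    (hy : y ∈ interior (hull A Set.univ)) (hyi : y ∈ hull A (F i)) (hyj : y ∈ hull A (F j))
    (hno : ∀ x ∈ interior (hull A Set.univ), ∃ m, x ∉ hull A (F m)) : CutOff A F := by
  obtain ⟨h, hs⟩ := C.exists_separates hij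
  set U := interior (hull A Set.univ) with hU
  have hUc : Convex ℝ U := (convex_hull A Set.univ).interior
  have hzero : ∀ x, x ∈ hull A (F i) → x ∈ hull A (F j) → h x = 0 := fun x h1 h2 =>
    le_antisymm (hs.nonpos x h1) (hs.nonneg x h2)
  have hconv : Convex ℝ {x | x ∈ U ∧ h x = 0} :=
    hUc.inter ((convex_singleton (0 : ℝ)).affine_preimage h)
  have hPi : ∀ j, interior (hull A (F j)) ⊆ U := fun j =>
    interior_mono (hull_mono A (Set.subset_univ _))
  have hside : ∀ a b, (∀ m, m = a ∨ m = b ∨ m = k) → ∀ g, Separates A g (F a) (F b) →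
      ∀ z ∈ U, g z = 0 → z ∉ hull A (F k) → z ∈ hull A (F a) := by
    intro a b hab g hg z hz hgz hzk
    obtain ⟨p, hp⟩ := C.interior_nonempty a
    refine mem_of_eventually_lineMap (isClosed_hull A _) (y := p) ?_
    have h1 : ∀ᶠ t in nhdsWithin (0 : ℝ) (Set.Ioi 0),
        AffineMap.lineMap z p t ∈ (hull A (F k))ᶜ := nhdsWithin_le_nhds
      (eventually_lineMap_mem ((isClosed_hull A _).isOpen_compl.interior_eq.symm ▸ hzk) p)
    filter_upwards [Ioo_mem_nhdsGT (zero_lt_one' ℝ), h1] with t ht htk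
    obtain ⟨m, hm⟩ := C.exists_mem ((convex_hull A Set.univ).lineMap_mem (interior_subset hz)
      (interior_subset (hPi a hp)) ⟨ht.1.le, ht.2.le⟩)
    rcases hab m with rfl | rfl | rfl
    · exact hm
    · have h3 := hg.nonneg _ hm
      rw [affine_lineMap, hgz] at h3
      have h4 := mul_neg_of_pos_of_neg ht.1 (hg.neg_of_interior hp)
      linarith
    · exact absurd hm htk
  have hnk : ∀ z ∈ U, h z = 0 → z ∉ hull A (F k) := by
    intro z hz hz0 hzk
    have hpre := isPreconnected_closed_iff.1 hconv.isPreconnected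
      (hull A (F i) ∩ hull A (F j)) (hull A (F k))
      ((isClosed_hull A _).inter (isClosed_hull A _)) (isClosed_hull A _)
    obtain ⟨x, ⟨hxU, -⟩, ⟨hxi, hxj⟩, hxk⟩ := hpre (fun x ⟨hx, hx0⟩ => by
        by_cases hxk : x ∈ hull A (F k)
        · exact Or.inr hxk
        · refine Or.inl ⟨hside i j hcov h hs x hx hx0 hxk, hside j i (fun m => ?_) (-h) hs.neg x hx
            (by simpa using hx0) hxk⟩
          rcases hcov m with h | h | h <;> simp [h])
      ⟨y, ⟨hy, hzero y hyi hyj⟩, hyi, hyj⟩ ⟨z, ⟨hz, hz0⟩, hzk⟩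
    obtain ⟨m, hm⟩ := hno x hxU
    rcases hcov m with rfl | rfl | rfl <;> exact hm ‹_›
  obtain ⟨q, hq⟩ := C.interior_nonempty k
  have hqs : h q ≠ 0 := fun h0 => hnk q (hPi k hq) h0 (interior_subset hq)
  have hkc : Convex ℝ (interior (hull A (F k))) := (convex_hull A (F k)).interior
  -- The interior of cell `k` lies strictly on one side, so the cell among `i`, `j` on the other
  -- side is cut off.
  rcases lt_or_gt_of_ne hqs with hq0 | hq0
  · refine ⟨j, -h, fun m hm => ?_⟩
    rcases hcov m with rfl | rfl | rfl
    · exact hs.neg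
    · exact absurd rfl hm
    · refine ⟨hs.neg.nonpos, ?_, hs.neg.ne_zero⟩
      refine C.subset_closed (K := {x | 0 ≤ (-h) x})
        (isClosed_le continuous_const (continuous_affine (-h))) fun x hx => ?_
      by_contra hx0
      obtain ⟨z, hz, hz0⟩ := exists_zero_of_sign hkc hq hx hq0 (by simpa using hx0)
      exact hnk z (hPi _ hz) hz0 (interior_subset hz)
  · refine ⟨i, h, fun m hm => ?_⟩
    rcases hcov m with rfl | rfl | rfl
    · exact absurd rfl hm
    · exact hs
    · refine ⟨hs.nonpos, ?_, hs.ne_zero⟩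
      refine C.subset_closed (K := {x | 0 ≤ h x})
        (isClosed_le continuous_const (continuous_affine h)) fun x hx => ?_
      by_contra hx0
      obtain ⟨z, hz, hz0⟩ := exists_zero_of_sign hkc hx hq (by simpa using hx0) hq0
      exact hnk z (hPi _ hz) hz0 (interior_subset hz)

theorem cutOff_of_no_center (C : Cells A S F)
    (hno : ∀ x ∈ interior (hull A Set.univ), ∃ m, x ∉ hull A (F m)) : CutOff A F := by
  have hPi : ∀ j, interior (hull A (F j)) ⊆ interior (hull A Set.univ) := fun j =>
    interior_mono (hull_mono A (Set.subset_univ _))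
  obtain ⟨p, hp⟩ := C.interior_nonempty 0
  obtain ⟨q, hq⟩ := C.interior_nonempty 1
  obtain ⟨y, hy, hy0, hy12⟩ := isPreconnected_closed_iff.1
    (convex_hull A Set.univ).interior.isPreconnected (hull A (F 0)) (hull A (F 1) ∪ hull A (F 2))
    (isClosed_hull A _) ((isClosed_hull A _).union (isClosed_hull A _))
    (fun x hx => by
      obtain ⟨j, hj⟩ := C.exists_mem (interior_subset hx)
      fin_cases j
      · exact Or.inl hj
      · exact Or.inr (Or.inl hj)
      · exact Or.inr (Or.inr hj))
    ⟨p, hPi 0 hp, interior_subset hp⟩ ⟨q, hPi 1 hq, Or.inl (interior_subset hq)⟩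
  rcases hy12 with hy1 | hy2
  · exact C.cutOff_of_mem_two (i := 0) (j := 1) (k := 2) (by decide) (by decide) (by decide)
      (by decide) hy hy0 hy1 hno
  · exact C.cutOff_of_mem_two (i := 0) (j := 2) (k := 1) (by decide) (by decide) (by decide)
      (by decide) hy hy0 hy2 hno

/-- A point of cell `j` has `h (j - 1) ≥ 0`, so the image of the hull under all three `h j` avoids
the open negative orthant. The separating functional gives `l`; its pullback is nonnegative on the
hull and zero at the interior point `x₀`, hence identically zero. -/
theorem exists_nonneg_relation (C : Cells A S F) {h : Fin 3 → Space d →ᵃ[ℝ] ℝ}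
    (hs : ∀ j, Separates A (h j) (F j) (F (j + 1))) {x₀ : Space d}
    (hx₀ : x₀ ∈ interior (hull A Set.univ)) (hx₀F : ∀ j, x₀ ∈ hull A (F j)) :
    ∃ l : Fin 3 → ℝ, (∀ j, 0 ≤ l j) ∧ (∃ j, 0 < l j) ∧ ∀ x, ∑ j, l j * h j x = 0 := by
  let s : Set (Fin 3 → ℝ) := {v | ∀ j, v j < 0}
  have hs_eq : s = Set.univ.pi fun _ => Set.Iio 0 := by ext; simp [s]
  have hsc : Convex ℝ s := hs_eq ▸ convex_pi fun _ _ => convex_Iio 0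
  have hso : IsOpen s := hs_eq ▸ isOpen_set_pi Set.finite_univ fun _ _ => isOpen_Iio
  let Φ : Space d →ᵃ[ℝ] (Fin 3 → ℝ) := AffineMap.pi h
  have hΦ : ∀ x j, Φ x j = h j x := fun x j => rfl
  have ht : Convex ℝ (Φ '' hull A Set.univ) := (convex_hull A Set.univ).affine_image Φ
  have h0 : ∀ j, h j x₀ = 0 := fun j =>
    le_antisymm ((hs j).nonpos _ (hx₀F j)) ((hs j).nonneg _ (hx₀F (j + 1)))
  have hdis : Disjoint s (Φ '' hull A Set.univ) := by
    rw [Set.disjoint_left]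
    rintro _ hv ⟨x, hx, rfl⟩
    obtain ⟨j, hj⟩ := C.exists_mem hx
    have h1 := (hs (j - 1)).nonneg x (by rwa [sub_add_cancel])
    have h2 : h (j - 1) x < 0 := hv (j - 1)
    linarith
  obtain ⟨f, u, hf, hfu⟩ := geometric_hahn_banach_open hsc hso ht hdis
  let l : Fin 3 → ℝ := fun j => f (Pi.single j 1)
  have hfl : ∀ v, f v = ∑ j, v j * l j := apply_eq_sum f.toLinearMap
  have hu0 : u ≤ 0 := by
    have := hfu _ ⟨x₀, interior_subset hx₀, rfl⟩
    rwa [hfl, Finset.sum_eq_zero fun j _ => by rw [hΦ, h0]; simp] at this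
  have hsum : 0 < ∑ j, l j := by
    have := hf (fun _ => -1) (fun j => by norm_num)
    rw [hfl] at this
    simp at this
    linarith
  have hu : 0 ≤ u := by
    by_contra hu
    push Not at hu
    have := hf (fun _ => u / ∑ j, l j) (fun j => div_neg_of_neg_of_pos hu hsum)
    rw [hfl, ← Finset.mul_sum, div_mul_cancel₀ _ hsum.ne'] at this
    exact lt_irrefl _ this
  have hl : ∀ j, 0 ≤ l j := by
    intro j
    by_contra hj
    push Not at hj
    -- If `l j < 0`, this vector of the negative orthant is chosen so that the functional takes the
    -- value `0`, contradicting `u ≤ 0`.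
    have := hf (fun k => (if k = j then (∑ j, l j) / l j else 0) - 1) (fun k => by
      have : (∑ j, l j) / l j < 0 := div_neg_of_pos_of_neg hsum hj
      dsimp only
      split_ifs <;> linarith)
    rw [hfl] at this
    simp [sub_mul, Finset.sum_sub_distrib, ite_mul, div_mul_cancel₀ _ hj.ne] at this
    linarith
  refine ⟨l, hl, ?_, fun x => ?_⟩
  · by_contra hne
    push Not at hne
    linarith [Finset.sum_nonpos fun j (_ : j ∈ Finset.univ) => hne j]
  · have e : ∀ x, (∑ j, l j • h j) x = ∑ j, l j * h j x := fun x => by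
      simp [Fin.sum_univ_three]
    rw [← e]
    refine eq_zero_of_interior (s := hull A Set.univ) (fun y hy => ?_) hx₀ ?_ x
    · have := hu.trans (hfu _ ⟨y, hy, rfl⟩)
      rw [hfl] at this
      rw [e]
      simpa [hΦ, mul_comm] using this
    · rw [e, Finset.sum_eq_zero fun j _ => by rw [h0]; simp]

theorem cutOff_or_coherent (C : Cells A S F) : CutOff A F ∨
    ∃ f, Coherent A F f ∧ ∃ x ∈ interior (hull A Set.univ), ∀ j, x ∈ hull A (F j) := by
  by_cases hc : ∃ x ∈ interior (hull A Set.univ), ∀ j, x ∈ hull A (F j)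
  swap
  · push Not at hc
    exact Or.inl (C.cutOff_of_no_center hc)
  obtain ⟨x₀, hx₀, hx₀F⟩ := hc
  have hsep : ∀ j : Fin 3, ∃ h, Separates A h (F j) (F (j + 1)) := fun j =>
    C.exists_separates (by fin_cases j <;> decide)
  choose h hs using hsep
  obtain ⟨l, hl, ⟨m, hm⟩, hrel⟩ := C.exists_nonneg_relation hs hx₀ hx₀F
  by_cases hpos : ∀ j, 0 < l j
  · right
    -- Partial sums of the relation: consecutive differences are rescaled separators, and the
    -- relation turns the remaining one into `-(l 2 • h 2)`.
    refine ⟨![0, l 0 • h 0, l 0 • h 0 + l 1 • h 1], coherent_of ?_ ?_ ?_, x₀, hx₀, hx₀F⟩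
    · simpa using (hs 0).smul (hpos 0)
    · simpa using (hs 1).smul (hpos 1)
    · have h2 := ((hs 2).smul (hpos 2)).neg
      have e : -(l 2 • h 2) = l 0 • h 0 + l 1 • h 1 := by
        ext x
        have := hrel x
        rw [Fin.sum_univ_three] at this
        simp
        linarith
      rw [e] at h2
      simpa using h2
  · left
    push Not at hpos
    obtain ⟨i, hi⟩ := hpos
    have hi : l i = 0 := le_antisymm hi (hl i)
    have hrel' : ∀ x, l (i + 1) * h (i + 1) x + l (i + 2) * h (i + 2) x = 0 := fun x => by
      have := hrel x
      rw [Fin.sum_univ_three] at this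
      fin_cases i <;> simp at hi ⊢ <;> simp [hi] at this <;> linarith
    have hcases : ∀ i k : Fin 3, k = i ∨ k = i + 1 ∨ k = i + 2 := by decide
    have hi3 : i + 1 + 1 = i + 2 := by rw [add_assoc]; rfl
    have hi4 : i + 2 + 1 = i := by fin_cases i <;> rfl
    have h1 : Separates A (h (i + 1)) (F (i + 1)) (F (i + 2)) := hi3 ▸ hs (i + 1)
    have h2 : Separates A (h (i + 2)) (F (i + 2)) (F i) := by
      have := hs (i + 2); rwa [hi4] at this
    have hp2 : 0 < l (i + 2) := by
      refine lt_of_le_of_ne (hl _) fun h0 => ?_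
      obtain ⟨y, hy⟩ := h1.ne_zero
      have h3 := hrel' y
      rw [← h0] at h3
      have h4 : l (i + 1) = 0 := by simpa [hy] using h3
      have : m = i ∨ m = i + 1 ∨ m = i + 2 := hcases i m
      rcases this with rfl | rfl | rfl <;> linarith
    have hp1 : 0 < l (i + 1) := by
      refine lt_of_le_of_ne (hl _) fun h0 => ?_
      obtain ⟨y, hy⟩ := h2.ne_zero
      have h3 := hrel' y
      rw [← h0] at h3
      have h4 : l (i + 2) = 0 := by simpa [hy] using h3
      linarith
    -- With `l i = 0`, `h (i + 2)` is a negative multiple of `h (i + 1)`, so its hyperplane also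
    -- separates cell `i + 2` from cell `i + 1`.
    refine ⟨i + 2, h (i + 2), fun k hk => ?_⟩
    rcases hcases i k with rfl | rfl | rfl
    · exact h2
    · refine ⟨h2.nonpos, fun x hx => ?_, h2.ne_zero⟩
      have h3 := h1.nonpos x hx
      have h4 := hrel' x
      have h5 := mul_nonneg hp1.le (neg_nonneg.2 h3)
      exact nonneg_of_mul_nonneg_right (by linarith) hp2
    · exact absurd rfl hk

end Cells

namespace Cells

variable {A : ι → Space d} {S : Set (Set ι)} {F : Fin 3 → Set ι} {f : Fin 3 → Space d →ᵃ[ℝ] ℝ}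

theorem eq_of_subset (C : Cells A S F) {j k : Fin 3} (h : F j ⊆ F k) : j = k :=
  C.injective ((C.maximal j).eq_of_subset (C.mem k) h)

theorem eq_on_common (hf : Coherent A F f) {x : Space d} {j k : Fin 3} (hj : x ∈ hull A (F j))
    (hk : x ∈ hull A (F k)) : f j x = f k x := by
  by_cases h : j = k
  · rw [h]
  · have h1 := (hf j k h).nonpos x hj
    have h2 := (hf j k h).nonneg x hk
    simp at h1 h2
    linarith

theorem le_on_hull (hf : Coherent A F f) {x : Space d} {j : Fin 3} (hj : x ∈ hull A (F j))
    (k : Fin 3) : f k x ≤ f j x := by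
  by_cases h : j = k
  · rw [h]
  · simpa using (hf j k h).nonpos x hj

variable [Finite ι]

/-! ### Coarsest subdivisions with three cells -/

theorem exists_mem_hull_of_nonneg (C : Cells A S F) {i : Fin 3} {h : Space d →ᵃ[ℝ] ℝ}
    (hs : ∀ k, k ≠ i → Separates A h (F i) (F k)) {x : Space d} (hx : x ∈ hull A Set.univ)
    (hx0 : 0 ≤ h x) : ∃ k, k ≠ i ∧ x ∈ hull A (F k) := by
  have hk : i + 1 ≠ i := by fin_cases i <;> decide
  obtain ⟨q, hq⟩ := C.interior_nonempty (i + 1)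
  have hK : IsClosed (⋃ k ∈ {k | k ≠ i}, hull A (F k)) :=
    (Set.toFinite _).isClosed_biUnion fun k _ => isClosed_hull A (F k)
  have : x ∈ ⋃ k ∈ {k | k ≠ i}, hull A (F k) := by
    refine mem_of_eventually_lineMap hK (y := q) ?_
    filter_upwards [Ioo_mem_nhdsGT (zero_lt_one' ℝ)] with t ht
    obtain ⟨j, hj⟩ := C.exists_mem ((convex_hull A Set.univ).lineMap_mem hx
      (hull_mono A (Set.subset_univ _) (interior_subset hq)) ⟨ht.1.le, ht.2.le⟩)
    refine Set.mem_biUnion (x := j) (fun hji => ?_) hj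
    subst hji
    have h3 := (hs _ hk).nonpos _ hj
    rw [affine_lineMap] at h3
    have h4 := (hs _ hk).pos hq
    have := ht.1
    have := ht.2
    nlinarith
  simpa using this

theorem not_isFace_univ (C : Cells A S F) (i : Fin 3) (H : Set ι) : ¬ IsFace A (F i) H := by
  rintro ⟨u, c, hu, -, -, he⟩
  obtain ⟨x, hx⟩ := C.interior_nonempty i
  have h0 : ∀ a ∈ F i, innerAffine u (-c) (A a) = 0 := fun a ha => by
    rw [he] at ha; simp [ha.2]
  have h1 : ∀ y ∈ hull A (F i), 0 ≤ innerAffine u (-c) y := fun y =>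
    nonneg_on_hull fun a ha => (h0 a ha).ge
  have h2 : 0 ≤ (-innerAffine u (-c)) x :=
    nonneg_on_hull (fun a ha => by rw [AffineMap.coe_neg, Pi.neg_apply, h0 a ha, neg_zero]) (interior_subset hx)
  have h3 : innerAffine u (-c) x = 0 := by
    rw [AffineMap.coe_neg, Pi.neg_apply] at h2
    linarith [h1 x (interior_subset hx)]
  have h4 := eq_zero_of_interior h1 hx h3
  have h5 := h4 u
  have h6 := h4 0
  simp at h5 h6
  rw [h6] at h5
  simp [hu] at h5

/-- Merges the two cells beyond the cutting hyperplane; the functions `0` and `h` exhibit the result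
as a two-cell subdivision. -/
theorem maxCells_of_separates (C : Cells A S F) {i : Fin 3} {h : Space d →ᵃ[ℝ] ℝ}
    (hs : ∀ k, k ≠ i → Separates A h (F i) (F k)) :
    MaxCells A ![F i, {a | ∃ k, k ≠ i ∧ a ∈ F k}] ![0, h] where
  nonempty j := by
    have h1 : i + 1 ≠ i := by fin_cases i <;> decide
    fin_cases j
    · exact C.sub.nonempty_of_mem _ (C.mem i)
    · obtain ⟨a, ha⟩ := C.sub.nonempty_of_mem _ (C.mem (i + 1))
      exact ⟨a, _, h1, ha⟩
  cover x hx := by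
    obtain ⟨j, hj⟩ := C.exists_mem hx
    rw [Set.mem_iUnion]
    by_cases hji : j = i
    · exact ⟨0, by subst hji; exact hj⟩
    · have hsub : F j ⊆ {a | ∃ k, k ≠ i ∧ a ∈ F k} := fun a ha => ⟨j, hji, ha⟩
      exact ⟨1, hull_mono A hsub hj⟩
  le := by
    rw [Fin.forall_fin_two, Fin.forall_fin_two, Fin.forall_fin_two]
    refine ⟨⟨fun a _ => le_rfl, fun a ha => ?_⟩, fun a ha => ?_, fun a _ => le_rfl⟩
    · have hk : i + 1 ≠ i := by fin_cases i <;> decide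
      simpa using (hs _ hk).nonpos _ (mem_hull A ha)
    · obtain ⟨k, hk, hak⟩ := ha
      simpa using (hs k hk).nonneg _ (mem_hull A hak)
  mem := by
    rw [Fin.forall_fin_two, Fin.forall_fin_two, Fin.forall_fin_two]
    refine ⟨⟨fun a ha _ => ha, fun a ha h0 => ?_⟩, fun a ha h0 => ?_, fun a ha _ => ha⟩
    · obtain ⟨k, hk, hak⟩ := ha
      exact C.sub.mem_of_mem_hull (C.mem k) (C.mem i) hak
        (C.mem_hull_of_nonpos (h := fun _ => h) hs (mem_hull A (Set.mem_univ a))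
          fun _ _ => by simpa using h0)
    · obtain ⟨k, hk, hak⟩ := C.exists_mem_hull_of_nonneg hs (mem_hull A (Set.mem_univ a))
        (by simpa using h0)
      exact ⟨k, hk, C.sub.mem_of_mem_hull (C.mem i) (C.mem k) ha hak⟩

/-- The merged subdivision coarsens `S`. It is not `S`, as a member properly contains a maximal
face, and not trivial, as it contains `F i`, which is neither everything nor contained in a
hyperplane. -/
theorem not_cutOff_of_isCoarsest (C : Cells A S F) (hS : IsCoarsest A S) : ¬ CutOff A F := by
  rintro ⟨i, h, hs⟩
  have M := C.maxCells_of_separates hs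
  obtain ⟨w, hw, hsub⟩ := M.exists_weight
  set T := regularSubdivision A w
  have hmem : ∀ j, ![F i, {a | ∃ k, k ≠ i ∧ a ∈ F k}] j ∈ T := fun j => by
    rw [hw]; exact ⟨j, WeakFace.refl A (M.nonempty j)⟩
  have h0 : F i ∈ T := hmem 0
  have h1 : {a | ∃ k, k ≠ i ∧ a ∈ F k} ∈ T := hmem 1
  have hi1 : i + 1 ≠ i := by fin_cases i <;> decide
  have hi2 : i + 2 ≠ i := by fin_cases i <;> decide
  have hi3 : i + 2 ≠ i + 1 := by fin_cases i <;> decide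
  have href : Refines S T := fun G hG => by
    obtain ⟨j, hj⟩ := C.mem_iff.1 hG
    by_cases hji : j = i
    · exact ⟨F i, h0, hji ▸ hj.subset⟩
    · exact ⟨_, h1, fun a ha => ⟨j, hji, hj.subset ha⟩⟩
  rcases hS.eq_of_refines T hsub href with hT | hT
  · rw [hT] at h1
    have h2 := (C.maximal (i + 1)).eq_of_subset h1 fun a ha => ⟨i + 1, hi1, ha⟩
    exact hi3 (C.eq_of_subset fun a ha => by rw [h2]; exact ⟨i + 2, hi2, ha⟩)
  · rw [hT] at h0
    rcases h0 with h0 | h0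
    · exact hi1 (C.eq_of_subset (h0 ▸ Set.subset_univ _))
    · exact C.not_isFace_univ i _ h0

/-! ### Intersections of cells around a common interior point -/

/-- The common labels of the cells with index in `I`. -/
def cap (F : Fin 3 → Set ι) (I : Finset (Fin 3)) : Set ι := {a | ∀ j ∈ I, a ∈ F j}

theorem mem_hull_of_le (C : Cells A S F) (hf : Coherent A F f) {x : Space d}
    (hx : x ∈ hull A Set.univ) {j : Fin 3} (h : ∀ k, f k x ≤ f j x) : x ∈ hull A (F j) :=
  C.mem_hull_of_nonpos (h := fun k => f k - f j) (fun k hk => hf j k hk.symm) hx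
    fun k _ => by simpa using h k

theorem eventually_mem_hull (C : Cells A S F) (hf : Coherent A F f) {y v : Space d} {i : Fin 3}
    (hy : y ∈ interior (hull A Set.univ))
    (h : ∀ k, f k y < f i y ∨ f k y = f i y ∧ f k v ≤ f i v) :
    ∀ᶠ t in nhdsWithin (0 : ℝ) (Set.Ioi 0), AffineMap.lineMap y v t ∈ hull A (F i) := by
  have h1 : ∀ k, ∀ᶠ t in nhdsWithin (0 : ℝ) (Set.Ioi 0),
      f k (AffineMap.lineMap y v t) ≤ f i (AffineMap.lineMap y v t) := by
    intro k
    rcases h k with hk | ⟨hk, hk'⟩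
    · have hc : ∀ k, Filter.Tendsto (fun t : ℝ => f k (AffineMap.lineMap y v t)) (nhds 0)
          (nhds (f k y)) := fun k => by
        have := ((continuous_affine (f k)).comp
          (AffineMap.lineMap_continuous (R := ℝ) (p := y) (q := v))).tendsto 0
        rw [Function.comp_apply, AffineMap.lineMap_apply_zero] at this
        exact this
      exact nhdsWithin_le_nhds (((hc k).eventually_lt (hc i) hk).mono fun _ h => h.le)
    · filter_upwards [self_mem_nhdsWithin] with t ht
      have ht : 0 < t := ht
      rw [affine_lineMap, affine_lineMap, hk]
      gcongr
  filter_upwards [Filter.eventually_all.2 h1, nhdsWithin_le_nhds (eventually_lineMap_mem hy v)]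
    with t ht htP
  exact C.mem_hull_of_le hf htP ht

/-- Affine independence of the linear parts; `t` absorbs a common shift. Otherwise some nonzero `l`
with sum zero satisfies `∑ l j * f j = 0`. Evaluating inside cell `i`, where `f i` is strictly
largest, forces the other two coefficients to have strictly opposite signs, and three numbers cannot
be pairwise of opposite sign. -/
theorem exists_spread (C : Cells A S F) (hf : Coherent A F f) {x : Space d}
    (hx : ∀ j, x ∈ hull A (F j)) (c : Fin 3 → ℝ) :
    ∃ (z : Space d) (t : ℝ), ∀ j, (f j).linear z = c j + t := by
  let Φ : (Space d × ℝ) →ₗ[ℝ] (Fin 3 → ℝ) := LinearMap.pi fun j =>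
    (f j).linear.comp (LinearMap.fst ℝ (Space d) ℝ) - LinearMap.snd ℝ (Space d) ℝ
  have hΦ : ∀ z t j, Φ (z, t) j = (f j).linear z - t := fun z t j => by simp [Φ]
  suffices hr : LinearMap.range Φ = ⊤ by
    obtain ⟨⟨z, t⟩, hzt⟩ := LinearMap.range_eq_top.1 hr c
    exact ⟨z, t, fun j => by have := hΦ z t j; rw [hzt] at this; linarith⟩
  by_contra hr
  obtain ⟨m, hm0, hm⟩ := Submodule.exists_le_ker_of_lt_top _ (lt_top_iff_ne_top.2 hr)
  let l : Fin 3 → ℝ := fun j => m (Pi.single j 1)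
  have hml : ∀ v, m v = ∑ j, v j * l j := apply_eq_sum m
  have hrel : ∀ z t, ∑ j, ((f j).linear z - t) * l j = 0 := fun z t => by
    have h1 : m (Φ (z, t)) = 0 := hm ⟨_, rfl⟩
    rw [hml] at h1
    simpa only [hΦ] using h1
  have hsum : l 0 + l 1 + l 2 = 0 := by
    have := hrel 0 (-1)
    simpa [Fin.sum_univ_three] using this
  have hlin : ∀ y, (f 0 y) * l 0 + f 1 y * l 1 + f 2 y * l 2 = 0 := fun y => by
    have h1 := hrel (y - x) 0
    have h2 : ∀ j, (f j).linear (y - x) = f j y - f j x := fun j => by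
      have := (f j).linearMap_vsub y x
      simpa using this
    simp only [Fin.sum_univ_three, h2, sub_zero] at h1
    have h3 := eq_on_common hf (hx 0) (hx 1)
    have h4 := eq_on_common hf (hx 0) (hx 2)
    rw [← h3, ← h4] at h1
    linear_combination h1 + f 0 x * hsum
  choose p hp using C.interior_nonempty
  have hlt : ∀ j k, j ≠ k → f k (p j) - f j (p j) < 0 := fun j k hjk => by
    simpa using (hf j k hjk).neg_of_interior (hp j)
  have hne : ¬ (l 0 = 0 ∧ l 1 = 0 ∧ l 2 = 0) := by
    rintro ⟨h0, h1, h2⟩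
    refine hm0 (LinearMap.ext fun v => ?_)
    rw [hml, Fin.sum_univ_three, h0, h1, h2]; simp
  have key : ∀ i j k : Fin 3, i ≠ j → i ≠ k →
      (∀ y, f i y * l i + f j y * l j + f k y * l k = 0) → l i + l j + l k = 0 →
      ¬ (l i = 0 ∧ l j = 0 ∧ l k = 0) →
      ¬ (0 ≤ l j ∧ 0 ≤ l k) ∧ ¬ (l j ≤ 0 ∧ l k ≤ 0) := by
    intro i j k hij hik h1 h2 h3
    have h4 := hlt i j hij
    have h5 := hlt i k hik
    have h6 : (f j (p i) - f i (p i)) * l j + (f k (p i) - f i (p i)) * l k = 0 := by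
      linear_combination h1 (p i) - f i (p i) * h2
    constructor
    · rintro ⟨h7, h8⟩
      have h9 := mul_nonpos_of_nonpos_of_nonneg h4.le h7
      have h10 := mul_nonpos_of_nonpos_of_nonneg h5.le h8
      have h11 : (f j (p i) - f i (p i)) * l j = 0 := by linarith
      have h12 : (f k (p i) - f i (p i)) * l k = 0 := by linarith
      have h13 := (mul_eq_zero.1 h11).resolve_left h4.ne
      have h14 := (mul_eq_zero.1 h12).resolve_left h5.ne
      exact h3 ⟨by linarith, h13, h14⟩
    · rintro ⟨h7, h8⟩
      have h9 := mul_nonneg_of_nonpos_of_nonpos h4.le h7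
      have h10 := mul_nonneg_of_nonpos_of_nonpos h5.le h8
      have h11 : (f j (p i) - f i (p i)) * l j = 0 := by linarith
      have h12 : (f k (p i) - f i (p i)) * l k = 0 := by linarith
      have h13 := (mul_eq_zero.1 h11).resolve_left h4.ne
      have h14 := (mul_eq_zero.1 h12).resolve_left h5.ne
      exact h3 ⟨by linarith, h13, h14⟩
  obtain ⟨a1, a2⟩ := key 0 1 2 (by decide) (by decide) hlin hsum hne
  obtain ⟨b1, b2⟩ := key 1 0 2 (by decide) (by decide) (fun y => by linarith [hlin y])
    (by linarith) (fun h => hne ⟨h.2.1, h.1, h.2.2⟩)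
  obtain ⟨c1, c2⟩ := key 2 0 1 (by decide) (by decide) (fun y => by linarith [hlin y])
    (by linarith) (fun h => hne ⟨h.2.1, h.2.2, h.1⟩)
  rcases le_total 0 (l 0) with h0 | h0 <;> rcases le_total 0 (l 1) with h1 | h1 <;>
    rcases le_total 0 (l 2) with h2 | h2 <;>
    first
    | exact a1 ⟨h1, h2⟩
    | exact a2 ⟨h1, h2⟩
    | exact b1 ⟨h0, h2⟩
    | exact b2 ⟨h0, h2⟩
    | exact c1 ⟨h0, h1⟩
    | exact c2 ⟨h0, h1⟩

theorem weakFace_cap (C : Cells A S F) (hf : Coherent A F f) {I : Finset (Fin 3)} {i : Fin 3}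
    (hi : i ∈ I) {x : Space d} (hx : ∀ j ∈ I, x ∈ hull A (F j)) :
    x ∈ hull A (cap F I) ∧ WeakFace A (cap F I) (F i) := by
  -- Every term is nonnegative on cell `i`, so the sum vanishes exactly where all functions indexed
  -- by `I` are tied.
  let g : Space d →ᵃ[ℝ] ℝ := ∑ j ∈ I, (f i - f j)
  have hg : ∀ y, g y = ∑ j ∈ I, (f i y - f j y) := fun y => by
    let ev : (Space d →ᵃ[ℝ] ℝ) →+ ℝ :=
      { toFun := fun g => g y, map_zero' := rfl, map_add' := fun _ _ => rfl }
    exact map_sum ev (fun j => f i - f j) I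
  have hle : ∀ a ∈ F i, ∀ j ∈ I, 0 ≤ f i (A a) - f j (A a) := fun a ha j _ =>
    sub_nonneg.2 (le_on_hull hf (mem_hull A ha) j)
  have hg0 : ∀ a ∈ F i, 0 ≤ g (A a) := fun a ha => by
    rw [hg]; exact Finset.sum_nonneg (hle a ha)
  have hcap : cap F I = {a | a ∈ F i ∧ g (A a) = 0} := by
    ext a
    constructor
    · intro ha
      refine ⟨ha i hi, ?_⟩
      rw [hg]
      exact Finset.sum_eq_zero fun j hj =>
        sub_eq_zero.2 (eq_on_common hf (mem_hull A (ha i hi)) (mem_hull A (ha j hj)))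
    · rintro ⟨ha, h0⟩ j hj
      rw [hg, Finset.sum_eq_zero_iff_of_nonneg (hle a ha)] at h0
      exact (C.maxCells hf).mem j i a ha (sub_nonpos.1 (h0 j hj).le)
  have hxc : x ∈ hull A (cap F I) := by
    rw [hcap]
    refine mem_hull_zero hg0 (hx i hi) ?_
    rw [hg]
    exact Finset.sum_eq_zero fun j hj => sub_eq_zero.2 (eq_on_common hf (hx i hi) (hx j hj))
  exact ⟨hxc, nonempty_of_mem_hull hxc, g, hg0, hcap⟩

theorem exists_mem_cap (C : Cells A S F) (hf : Coherent A F f) {x : Space d}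
    (hxP : x ∈ interior (hull A Set.univ)) (hx : ∀ j, x ∈ hull A (F j)) {I : Finset (Fin 3)}
    (hI : I.Nonempty) : ∃ y ∈ interior (hull A Set.univ), y ∈ hull A (cap F I) ∧
      ∀ i ∈ I, ∀ k ∉ I, f k y < f i y := by
  classical
  -- Along `z` the functions in `I` stay tied while the others fall behind.
  obtain ⟨z, s, hz⟩ := C.exists_spread hf hx (fun j => if j ∈ I then 0 else -1)
  have hfz : ∀ j, f j (x + z) = f j x + ((if j ∈ I then 0 else -1) + s) := fun j => by
    rw [← hz j, add_comm x z, ← vadd_eq_add, AffineMap.map_vadd, vadd_eq_add, add_comm]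
  have hxx : ∀ j k, f j x = f k x := fun j k => eq_on_common hf (hx j) (hx k)
  have h1 : ∀ i : Fin 3, ∀ᶠ t in nhdsWithin (0 : ℝ) (Set.Ioi 0),
      i ∈ I → AffineMap.lineMap x (x + z) t ∈ hull A (F i) := by
    intro i
    by_cases hi : i ∈ I
    · refine (C.eventually_mem_hull hf hxP (v := x + z) (i := i) fun k =>
        Or.inr ⟨hxx k i, ?_⟩).mono fun t ht _ => ht
      rw [hfz, hfz, hxx k i]
      simp only [hi, if_true]
      split_ifs <;> linarith
    · exact Filter.Eventually.of_forall fun t h => absurd h hi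
  have h2 : ∀ᶠ t in nhdsWithin (0 : ℝ) (Set.Ioi 0),
      AffineMap.lineMap x (x + z) t ∈ interior (hull A Set.univ) :=
    nhdsWithin_le_nhds (eventually_lineMap_mem (by rwa [interior_interior]) _)
  obtain ⟨t, ⟨h3, h4⟩, ht⟩ :=
    (((Filter.eventually_all.2 h1).and h2).and self_mem_nhdsWithin).exists
  have ht : 0 < t := ht
  obtain ⟨i, hi⟩ := hI
  refine ⟨_, h4, (C.weakFace_cap hf hi fun j hj => h3 j hj).1, fun i hi k hk => ?_⟩
  rw [affine_lineMap, affine_lineMap, hfz, hfz, hxx k i]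
  simp only [hi, hk, if_true, if_false]
  nlinarith

/-- For the harder direction, start where the functions in `I` are tied and strictly dominate the
rest: a small step along `z` keeps the ties and the strict inequalities, so it stays in the hull of
the cap. -/
theorem vectorSpan_cap (C : Cells A S F) (hf : Coherent A F f) {x : Space d}
    (hxP : x ∈ interior (hull A Set.univ)) (hx : ∀ j, x ∈ hull A (F j)) {I : Finset (Fin 3)}
    (hI : I.Nonempty) (z : Space d) : z ∈ vectorSpan ℝ (A '' cap F I) ↔
      ∀ i ∈ I, ∀ j ∈ I, (f i).linear z = (f j).linear z := by
  constructor
  · intro hz i hi j hj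
    have hle : vectorSpan ℝ (A '' cap F I) ≤ LinearMap.ker ((f i).linear - (f j).linear) := by
      rw [vectorSpan_def, Submodule.span_le]
      rintro _ ⟨_, ⟨a, ha, rfl⟩, _, ⟨b, hb, rfl⟩, rfl⟩
      have h1 := eq_on_common hf (mem_hull A (ha i hi)) (mem_hull A (ha j hj))
      have h2 := eq_on_common hf (mem_hull A (hb i hi)) (mem_hull A (hb j hj))
      rw [SetLike.mem_coe, LinearMap.mem_ker, LinearMap.sub_apply, AffineMap.linearMap_vsub,
        AffineMap.linearMap_vsub, h1, h2, sub_self]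
    have := hle hz
    rw [LinearMap.mem_ker, LinearMap.sub_apply] at this
    linarith
  · intro hz
    obtain ⟨y, hyP, hy, hlt⟩ := C.exists_mem_cap hf hxP hx hI
    have hyj : ∀ j ∈ I, y ∈ hull A (F j) := fun j hj =>
      hull_mono A (show cap F I ⊆ F j from fun a ha => ha j hj) hy
    have hfz : ∀ j, f j (y + z) = f j y + (f j).linear z := fun j => by
      rw [add_comm y z, ← vadd_eq_add, AffineMap.map_vadd, vadd_eq_add, add_comm]
    have h1 : ∀ i : Fin 3, ∀ᶠ t in nhdsWithin (0 : ℝ) (Set.Ioi 0),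
        i ∈ I → AffineMap.lineMap y (y + z) t ∈ hull A (F i) := by
      intro i
      by_cases hi : i ∈ I
      · refine (C.eventually_mem_hull hf hyP (v := y + z) (i := i) fun k => ?_).mono fun t ht _ => ht
        by_cases hk : k ∈ I
        · have := eq_on_common hf (hyj k hk) (hyj i hi)
          exact Or.inr ⟨this, by rw [hfz, hfz, this, hz k hk i hi]⟩
        · exact Or.inl (hlt i hi k hk)
      · exact Filter.Eventually.of_forall fun t h => absurd h hi
    obtain ⟨t, h3, ht⟩ := ((Filter.eventually_all.2 h1).and self_mem_nhdsWithin).exists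
    have ht : 0 < t := ht
    obtain ⟨i, hi⟩ := hI
    have h4 := (C.weakFace_cap hf hi fun j hj => h3 j hj).1
    have h5 := vsub_mem_vectorSpan ℝ h4 hy
    rw [hull, ← direction_affineSpan, affineSpan_convexHull, direction_affineSpan] at h5
    have h6 : AffineMap.lineMap y (y + z) t -ᵥ y = t • z := by
      simp [AffineMap.lineMap_apply]
    rw [h6] at h5
    exact (Submodule.smul_mem_iff _ ht.ne').1 h5

/-- Rank-nullity for `Ψ (z, t) = ((f j).linear z - t)` over `j ∈ I`: it is surjective by
`exists_spread`, its kernel projects isomorphically onto the direction space of the cap, and the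
extra coordinate `t` accounts for the `+ 1`. -/
theorem dim_cap (C : Cells A S F) (hf : Coherent A F f) {x : Space d}
    (hxP : x ∈ interior (hull A Set.univ)) (hx : ∀ j, x ∈ hull A (F j)) {I : Finset (Fin 3)}
    (hI : I.Nonempty) : dim A (cap F I) + I.card = d + 1 := by
  classical
  let Ψ : (Space d × ℝ) →ₗ[ℝ] (I → ℝ) := LinearMap.pi fun j =>
    (f j).linear.comp (LinearMap.fst ℝ (Space d) ℝ) - LinearMap.snd ℝ (Space d) ℝ
  have hΨ : ∀ z t j, Ψ (z, t) j = (f j).linear z - t := fun z t j => by simp [Ψ]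
  have hsurj : LinearMap.range Ψ = ⊤ := LinearMap.range_eq_top.2 fun c => by
    obtain ⟨z, t, hz⟩ := C.exists_spread hf hx fun j => if h : j ∈ I then c ⟨j, h⟩ else 0
    refine ⟨(z, t), funext fun j => ?_⟩
    rw [hΨ, hz]
    simp
  obtain ⟨i, hi⟩ := hI
  let π : LinearMap.ker Ψ →ₗ[ℝ] Space d := (LinearMap.fst ℝ (Space d) ℝ).domRestrict _
  have hker : ∀ p : LinearMap.ker Ψ, ∀ j ∈ I, (f j).linear p.1.1 = p.1.2 := fun p j hj => by
    have h1 := congrFun (LinearMap.mem_ker.1 p.2) ⟨j, hj⟩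
    rw [← Prod.mk.eta (p := p.1), hΨ] at h1
    exact sub_eq_zero.1 h1
  have hπ : Function.Injective π := by
    intro p q hpq
    have h1 : p.1.1 = q.1.1 := hpq
    refine Subtype.ext (Prod.ext h1 ?_)
    rw [← hker p i hi, ← hker q i hi, h1]
  have hrange : LinearMap.range π = vectorSpan ℝ (A '' cap F I) := by
    ext z
    rw [C.vectorSpan_cap hf hxP hx ⟨i, hi⟩]
    constructor
    · rintro ⟨p, rfl⟩ j hj k hk
      exact (hker p j hj).trans (hker p k hk).symm
    · intro hz
      refine ⟨⟨(z, (f i).linear z), LinearMap.mem_ker.2 (funext fun j => ?_)⟩, rfl⟩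
      rw [hΨ, hz j.1 j.2 i hi, sub_self]; rfl
  have h1 := LinearMap.finrank_range_add_finrank_ker Ψ
  rw [hsurj, finrank_top, ← LinearMap.finrank_range_of_inj hπ, hrange] at h1
  simp at h1
  rw [dim]
  omega

theorem eq_cap (C : Cells A S F) (hf : Coherent A F f) {G : Set ι} (hG : G ∈ S)
    (hGi : IsInterior A G) : ∃ I : Finset (Fin 3), I.Nonempty ∧ (∀ j, j ∈ I ↔ G ⊆ F j) ∧
      G = cap F I := by
  classical
  obtain ⟨x, hxG, hxf⟩ := Set.not_subset.1 hGi
  have hxP : x ∈ interior (hull A Set.univ) := by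
    by_contra h
    exact hxf ⟨subset_closure (hull_mono A (Set.subset_univ G) hxG), h⟩
  obtain ⟨x', hx'⟩ := Set.Nonempty.intrinsicInterior (convex_hull A G) ⟨x, hxG⟩
  have hx'G := intrinsicInterior_subset hx'
  have hm : AffineMap.lineMap x x' (1 / 2 : ℝ) ∈ openSegment ℝ x x' :=
    lineMap_mem_openSegment ℝ x x' ⟨by norm_num, by norm_num⟩
  -- The midpoint is interior to the whole hull, and any cell containing it also contains the
  -- relative interior point `x'` of `G`, so has `G` as a weak face.
  set m := AffineMap.lineMap x x' (1 / 2 : ℝ)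
  have hmP : m ∈ interior (hull A Set.univ) :=
    (convex_hull A Set.univ).openSegment_interior_self_subset_interior hxP
      (hull_mono A (Set.subset_univ G) hx'G) hm
  have hmG : m ∈ hull A G := (convex_hull A G).openSegment_subset hxG hx'G hm
  have hiff : ∀ j, m ∈ hull A (F j) → WeakFace A G (F j) := fun j hj =>
    C.sub.weakFace_of_mem hG (C.mem j) hx'
      (C.sub.mem_hull_of_openSegment hG (C.mem j) hxG hx'G hj hm).2
  have hiff' : ∀ j, G ⊆ F j ↔ m ∈ hull A (F j) := fun j =>
    ⟨fun h => hull_mono A h hmG, fun h => (hiff j h).subset⟩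
  obtain ⟨i, hi⟩ := C.exists_mem (interior_subset hmP)
  refine ⟨Finset.univ.filter fun j => G ⊆ F j, ⟨i, by simpa [hiff'] using hi⟩, by simp, ?_⟩
  refine Set.Subset.antisymm (fun a ha j hj => (Finset.mem_filter.1 hj).2 ha) fun a ha => ?_
  have hai : ∀ j, m ∈ hull A (F j) → a ∈ F j := fun j hj =>
    ha j (Finset.mem_filter.2 ⟨Finset.mem_univ j, (hiff' j).2 hj⟩)
  -- Moving towards the reflection of `A a` in `m` keeps the ties at `m`, so it stays in cell `i`.
  -- Hence `m` is inside a segment of cell `i` ending at `A a`, and the face `G`, whose hull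
  -- contains `m`, contains `a`.
  have h1 := C.eventually_mem_hull hf (y := m) (v := AffineMap.lineMap m (A a) (-1 : ℝ)) (i := i)
    hmP fun k => by
      by_cases hk : m ∈ hull A (F k)
      · have h2 := eq_on_common hf hk hi
        have h3 := eq_on_common hf (mem_hull A (hai k hk)) (mem_hull A (hai i hi))
        exact Or.inr ⟨h2, by rw [affine_lineMap (f k) m, affine_lineMap (f i) m, h2, h3]⟩
      · left
        by_contra h
        push Not at h
        exact hk (C.mem_hull_of_le hf (interior_subset hmP) fun l =>
          (le_on_hull hf hi l).trans h)
  obtain ⟨t, h2, ht⟩ := (h1.and self_mem_nhdsWithin).exists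
  have h3 : AffineMap.lineMap m (AffineMap.lineMap m (A a) (-1 : ℝ)) t =
      AffineMap.lineMap m (A a) (-t) := by
    simp only [AffineMap.lineMap_apply, vsub_eq_sub, vadd_eq_add, add_sub_cancel_right, smul_smul]
    ring_nf
  rw [h3] at h2
  exact (hiff i hi).mem_of_mem_hull (hai i hi)
    ((hiff i hi).mem_hull_of_openSegment (mem_hull A (hai i hi)) h2 hmG
      (mem_openSegment_lineMap_neg m (A a) ht)).1

theorem cap_mem (C : Cells A S F) (hf : Coherent A F f) {x : Space d}
    (hxP : x ∈ interior (hull A Set.univ)) (hx : ∀ j, x ∈ hull A (F j)) {I : Finset (Fin 3)}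
    (hI : I.Nonempty) : cap F I ∈ S ∧ IsInterior A (cap F I) := by
  obtain ⟨i, hi⟩ := hI
  obtain ⟨h1, h2⟩ := C.weakFace_cap hf hi fun j _ => hx j
  exact ⟨C.sub.weakFace_mem (C.mem i) h2, fun h => (h h1).2 hxP⟩

theorem cap_subset_iff (C : Cells A S F) (hf : Coherent A F f) {x : Space d}
    (hxP : x ∈ interior (hull A Set.univ)) (hx : ∀ j, x ∈ hull A (F j)) {I : Finset (Fin 3)}
    (hI : I.Nonempty) (k : Fin 3) : cap F I ⊆ F k ↔ k ∈ I := by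
  refine ⟨fun h => ?_, fun hk a ha => ha k hk⟩
  by_contra hk
  obtain ⟨y, -, hy, hlt⟩ := C.exists_mem_cap hf hxP hx hI
  obtain ⟨i, hi⟩ := hI
  have := le_on_hull hf (hull_mono A h hy) i
  linarith [hlt i hi k hk]

theorem tightSpanIsTriangle (C : Cells A S F) (hf : Coherent A F f) {x : Space d}
    (hxP : x ∈ interior (hull A Set.univ)) (hx : ∀ j, x ∈ hull A (F j)) :
    TightSpanIsTriangle A S := by
  have hcap := fun G : TightSpan A S =>
    C.eq_cap hf (OrderDual.ofDual G).2.1 (OrderDual.ofDual G).2.2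
  choose I hne hI hIeq using hcap
  have hright : ∀ s : {s : Finset (Fin 3) // s.Nonempty},
      I (OrderDual.toDual ⟨cap F s.1, C.cap_mem hf hxP hx s.2⟩) = s.1 := fun s => by
    ext k
    rw [hI]
    exact C.cap_subset_iff hf hxP hx s.2 k
  let e : TightSpan A S ≃o {s : Finset (Fin 3) // s.Nonempty} :=
    { toFun := fun G => ⟨I G, hne G⟩
      invFun := fun s => OrderDual.toDual ⟨cap F s.1, C.cap_mem hf hxP hx s.2⟩
      left_inv := fun G => OrderDual.ofDual.injective (Subtype.ext (hIeq G).symm)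
      right_inv := fun s => Subtype.ext (hright s)
      map_rel_iff' := by
        intro G H
        change I G ⊆ I H ↔ (OrderDual.ofDual H).1 ⊆ (OrderDual.ofDual G).1
        constructor
        · intro h a ha
          rw [hIeq] at ha ⊢
          exact fun j hj => ha j (h hj)
        · intro h j hj
          rw [hI] at hj ⊢
          exact h.trans hj }
  refine ⟨e, fun G => ?_⟩
  have h1 := C.dim_cap hf hxP hx (hne G)
  have h2 := (hne G).card_pos
  have h3 : (e G).1 = I G := rfl
  rw [TightSpan.faceDim, h3, hIeq G]
  omega

end Cells

/-! ### Assembly of the theorem -/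

theorem IsSubdivision.exists_cells_three {A : ι → Space d}
    (hA : affineSpan ℝ (Set.range A) = ⊤) {S : Set (Set ι)} (hS : IsSubdivision A S)
    (h : (maximalFaces S).encard = 3) : ∃ F : Fin 3 → Set ι, Cells A S F := by
  obtain ⟨F, G, H, hFG, hFH, hGH, hF⟩ := Set.encard_eq_three.1 h
  refine ⟨![F, G, H], hS, fun i j hij => ?_, ?_, hA⟩
  · fin_cases i <;> fin_cases j <;> simp_all
  · rw [hF]
    ext K
    simp only [Set.mem_range, Fin.exists_fin_succ, Set.mem_insert_iff, Set.mem_singleton_iff]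
    simp [eq_comm]

theorem IsSubdivision.isRegular_of_encard_le [Finite ι] {A : ι → Space d}
    (hA : affineSpan ℝ (Set.range A) = ⊤) {S : Set (Set ι)} (hS : IsSubdivision A S)
    (h : (maximalFaces S).encard ≤ 3) : IsRegular A S := by
  have hcases : (maximalFaces S).encard = 0 ∨ (maximalFaces S).encard = 1 ∨
      (maximalFaces S).encard = 2 ∨ (maximalFaces S).encard = 3 := by
    obtain ⟨n, hn⟩ := ENat.ne_top_iff_exists.1 (ne_top_of_le_ne_top (ENat.natCast_ne_top 3) h)
    rw [← hn] at h ⊢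
    norm_cast at h ⊢
    omega
  rcases hcases with h | h | h | h
  · obtain ⟨x, hx⟩ := interior_hull_univ_nonempty hA
    have := hS.hull_subset_maximal (interior_subset hx)
    rw [Set.encard_eq_zero.1 h] at this
    simp at this
  · obtain ⟨F, hF⟩ := Set.encard_eq_one.1 h
    have C : Cells A S (fun _ : Fin 1 => F) :=
      ⟨hS, Function.injective_of_subsingleton _, by rw [hF, Set.range_const], hA⟩
    -- With a single cell coherence is vacuous; with two, a single separator suffices.
    exact C.isRegular (f := 0) fun j k hjk => absurd (Subsingleton.elim j k) hjk
  · obtain ⟨F, G, hFG, hF⟩ := Set.encard_eq_two.1 h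
    have C : Cells A S ![F, G] := by
      refine ⟨hS, fun i j hij => ?_, by rw [hF]; simp [Set.pair_comm], hA⟩
      fin_cases i <;> fin_cases j <;> simp_all
    obtain ⟨h, hs⟩ := C.exists_separates (show (0 : Fin 2) ≠ 1 by decide)
    refine C.isRegular (f := ![0, h]) fun j k hjk => ?_
    have hs' := hs.neg
    fin_cases j <;> fin_cases k
    · exact absurd rfl hjk
    · simpa using hs
    · simpa using hs'
    · exact absurd rfl hjk
  · obtain ⟨F, C⟩ := hS.exists_cells_three hA h
    rcases C.cutOff_or_coherent with hc | ⟨f, hf, -⟩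
    · exact C.isRegular_of_cutOff hc
    · exact C.isRegular hf

end PointConfig

theorem mainTheorem11 {d : ℕ} {ι : Type*} [Finite ι] (A : ι → PointConfig.Space d)
    (hA : affineSpan ℝ (Set.range A) = ⊤) :
    (∀ S : Set (Set ι), PointConfig.IsKSubdivision A 3 S →
      PointConfig.TightSpanIsTriangle A S ∧ PointConfig.IsKSplit A 3 S) ∧
    (∀ S : Set (Set ι), PointConfig.IsSubdivision A S →
      (PointConfig.maximalFaces S).encard ≤ 3 → PointConfig.IsRegular A S) := by
  refine ⟨fun S hS => ?_, fun S hS h => hS.isRegular_of_encard_le hA h⟩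
  obtain ⟨F, C⟩ := hS.1.isSubdivision.exists_cells_three hA hS.2
  obtain ⟨f, hf, x, hxP, hx⟩ :=
    C.cutOff_or_coherent.resolve_left (C.not_cutOff_of_isCoarsest hS.1)
  obtain ⟨h1, h2⟩ := C.cap_mem hf hxP hx Finset.univ_nonempty
  exact ⟨C.tightSpanIsTriangle hf hxP hx, hS, _, h1, h2,
    by simpa using C.dim_cap hf hxP hx Finset.univ_nonempty⟩
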